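/- Let $v:\mathbb Z\to\mathbb R$ be bounded, and let $h$ be the Jacobi matrix on $\ell^2(\mathbb Z)$, $$(hu)(m)=u(m+1)+u(m-1)+v(m)u(m).$$ Fix $n\in\mathbb Z$, and let $h_D^n$ be the Dirichlet-decoupled operator at $n$, that is, the compression of $h$ to the subspace $\{u\in\ell^2(\mathbb Z): u(n)=0\}=\ell^2(m<n)\oplus\ell^2(m>n)$. For a continuous function $f$ on $\mathbb R$ with a finite limit $f(+\infty)$ at $+\infty$, extend $f(h_D^n)$ to $\ell^2(\mathbb Z)$ by letting it act on the span of the unit vector $\delta_n$ as multiplication by $f(+\infty)$ (so resolvents of $h_D^n$ are extended by zero). Then there is a function $\xi(n,\cdot):\mathbb R\to\mathbb R$, measurable and unique up to Lebesgue-null sets (the Krein spectral shift function), such that: - for every $f\in C^2(\mathbb R)$ with $\sup_\lambda |(1+\lambda^2)f'(\lambda)|<\infty$, the operator $f(h)-f(h_D^n)$ is trace class and $$\operatorname{tr}\bigl(f(h)-f(h_D^n)\bigr)=-\int_{-\infty}^{\infty} f'(\lambda)\,\xi(n,\lambda)\,d\lambda;$$ - $0\le\xi(n,\lambda)\le 1$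 for a.e. $\lambda$; - $\xi(n,\lambda)=0$ for a.e. $\lambda<\inf\operatorname{spec}(h)$. Moreover, for all real $E_-\le\inf\operatorname{spec}(h)$ and $E_+\ge\sup\operatorname{spec}(h)$, the function $\tfrac12-\xi(n,\cdot)$ is integrable on $[E_-,E_+]$ and $$v(n)=\tfrac12(E_-+E_+)+\int_{E_-}^{E_+}\Bigl(\tfrac12-\xi(n,\lambda)\Bigr)\,d\lambda .$$ -/

import Mathlib

open MeasureTheory Filter Topology
open scoped InnerProductSpace ENNReal

noncomputable section

namespace JacobiTrace

/-- The complex Hilbert space of square summable two-sided sequences. -/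
abbrev SeqSpace : Type := lp (fun _ : ℤ => ℂ) 2

/-- The unit vector at the site `n`. -/
def delta (n : ℤ) : SeqSpace := lp.single 2 n 1

theorem memlp_shift (k : ℤ) (u : SeqSpace) :
    Memℓp (fun m : ℤ => u (m + k)) 2 := by
  apply memℓp_gen
  exact ((lp.memℓp u).summable (by norm_num)).comp_injective (Equiv.addRight k).injective

/-- The translation `u ↦ (m ↦ u (m + k))`. -/
def shift (k : ℤ) : SeqSpace →L[ℂ] SeqSpace :=
  LinearMap.mkContinuous
    { toFun := fun u => ⟨fun m : ℤ => u (m + k), memlp_shift k u⟩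
      map_add' := fun _ _ => rfl
      map_smul' := fun _ _ => rfl }
    1
    (fun u => by
      rw [one_mul]
      refine lp.norm_le_of_tsum_le (by norm_num) (norm_nonneg _) ?_
      rw [lp.norm_rpow_eq_tsum (by norm_num) u]
      exact ((Equiv.addRight k).tsum_eq
        (fun m : ℤ => ‖u m‖ ^ (2 : ℝ≥0∞).toReal)).le)

@[simp] theorem shift_apply (k : ℤ) (u : SeqSpace) (m : ℤ) : shift k u m = u (m + k) := rfl

theorem norm_rpow_mul_le {v : ℤ → ℝ} {C : ℝ} (hC : ∀ m, |v m| ≤ C) (u : SeqSpace) (m : ℤ) :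
    ‖(v m : ℂ) * u m‖ ^ (2 : ℝ≥0∞).toReal
      ≤ C ^ (2 : ℝ≥0∞).toReal * ‖u m‖ ^ (2 : ℝ≥0∞).toReal := by
  have h0 : 0 ≤ C := (abs_nonneg _).trans (hC 0)
  rw [← Real.mul_rpow h0 (norm_nonneg _), norm_mul, Complex.norm_real, Real.norm_eq_abs]
  exact Real.rpow_le_rpow (by positivity)
    (mul_le_mul_of_nonneg_right (hC m) (norm_nonneg _)) (by norm_num)

theorem memlp_diag {v : ℤ → ℝ} {C : ℝ} (hC : ∀ m, |v m| ≤ C) (u : SeqSpace) :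
    Memℓp (fun m : ℤ => (v m : ℂ) * u m) 2 := by
  apply memℓp_gen
  exact Summable.of_nonneg_of_le (fun _ => by positivity) (norm_rpow_mul_le hC u)
    (((lp.memℓp u).summable (by norm_num)).mul_left _)

/-- Multiplication by a bounded real sequence. -/
def diag (v : ℤ → ℝ) (hv : ∃ C, ∀ m, |v m| ≤ C) : SeqSpace →L[ℂ] SeqSpace :=
  LinearMap.mkContinuous
    { toFun := fun u => ⟨fun m : ℤ => (v m : ℂ) * u m, memlp_diag hv.choose_spec u⟩
      map_add' := fun u w => by ext m; exact mul_add _ _ _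
      map_smul' := fun c u => by ext m; exact mul_left_comm _ _ _ }
    hv.choose
    (fun u => by
      have h0 : 0 ≤ hv.choose := (abs_nonneg _).trans (hv.choose_spec 0)
      refine lp.norm_le_of_tsum_le (by norm_num) (by positivity) ?_
      rw [Real.mul_rpow h0 (norm_nonneg _), lp.norm_rpow_eq_tsum (by norm_num) u, ← tsum_mul_left]
      have hs := (lp.memℓp u).summable (p := 2) (by norm_num)
      exact Summable.tsum_le_tsum (norm_rpow_mul_le hv.choose_spec u)
        ((memlp_diag hv.choose_spec u).summable (by norm_num)) (hs.mul_left _))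

/-- The Jacobi matrix `(h u)(m) = u (m + 1) + u (m - 1) + v m * u m`. -/
def jacobi (v : ℤ → ℝ) (hv : ∃ C, ∀ m, |v m| ≤ C) : SeqSpace →L[ℂ] SeqSpace :=
  shift 1 + shift (-1) + diag v hv

theorem jacobi_apply (v : ℤ → ℝ) (hv : ∃ C, ∀ m, |v m| ≤ C) (u : SeqSpace) (m : ℤ) :
    jacobi v hv u m = u (m + 1) + u (m - 1) + (v m : ℂ) * u m := rfl

/-- The sequences that vanish at `n`, that is `ℓ²(m < n) ⊕ ℓ²(m > n)`. -/
abbrev dirichletSpace (n : ℤ) : Submodule ℂ SeqSpace := (ℂ ∙ delta n)ᗮ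

theorem mem_dirichletSpace_iff (n : ℤ) (u : SeqSpace) : u ∈ dirichletSpace n ↔ u n = 0 := by
  rw [Submodule.mem_orthogonal_singleton_iff_inner_right, delta, lp.inner_single_left]
  simp

/-- The Dirichlet-decoupled operator at the site `n`: the compression of `h` to the sequences
that vanish at `n`. -/
def dirichlet (v : ℤ → ℝ) (hv : ∃ C, ∀ m, |v m| ≤ C) (n : ℤ) :
    dirichletSpace n →L[ℂ] dirichletSpace n :=
  (dirichletSpace n).orthogonalProjectionOnto ∘L jacobi v hv ∘L (dirichletSpace n).subtypeL

theorem isSelfAdjoint_jacobi (v : ℤ → ℝ) (hv : ∃ C, ∀ m, |v m| ≤ C) :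
    IsSelfAdjoint (jacobi v hv) := by
  rw [ContinuousLinearMap.isSelfAdjoint_iff_isSymmetric]
  have hshift (u w : SeqSpace) : ⟪shift 1 u, w⟫_ℂ = ⟪u, shift (-1) w⟫_ℂ := by
    rw [lp.inner_eq_tsum, lp.inner_eq_tsum,
      ← (Equiv.addRight (1 : ℤ)).tsum_eq (fun m : ℤ => ⟪u m, shift (-1) w m⟫_ℂ)]
    simp
  have hdiag (u w : SeqSpace) : ⟪diag v hv u, w⟫_ℂ = ⟪u, diag v hv w⟫_ℂ := by
    rw [lp.inner_eq_tsum, lp.inner_eq_tsum]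
    refine tsum_congr fun m => ?_
    change ⟪(v m : ℂ) * u m, w m⟫_ℂ = ⟪u m, (v m : ℂ) * w m⟫_ℂ
    simp [mul_assoc, mul_left_comm]
  intro u w
  change ⟪shift 1 u + shift (-1) u + diag v hv u, w⟫_ℂ
    = ⟪u, shift 1 w + shift (-1) w + diag v hv w⟫_ℂ
  have h1 := hshift u w
  have h2 : ⟪shift (-1) u, w⟫_ℂ = ⟪u, shift 1 w⟫_ℂ := by
    rw [← inner_conj_symm, ← hshift w u, inner_conj_symm]
  simp only [inner_add_left, inner_add_right, h1, h2, hdiag u w]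
  ring

theorem isSelfAdjoint_dirichlet (v : ℤ → ℝ) (hv : ∃ C, ∀ m, |v m| ≤ C) (n : ℤ) :
    IsSelfAdjoint (dirichlet v hv n) := by
  rw [ContinuousLinearMap.isSelfAdjoint_iff_isSymmetric]
  intro u w
  have h := ContinuousLinearMap.isSelfAdjoint_iff_isSymmetric.mp (isSelfAdjoint_jacobi v hv)
    (u : SeqSpace) (w : SeqSpace)
  simpa [dirichlet] using h

/-- `f(A)` for a bounded self-adjoint operator `A` on a Hilbert space. -/
def funcCalc {H : Type*} [NormedAddCommGroup H] [InnerProductSpace ℂ H] [CompleteSpace H]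
    (f : ℝ → ℝ) (A : H →L[ℂ] H) : H →L[ℂ] H :=
  cfc f A

/-- `f(h_D)` as an operator on the whole space, where `h_D` is decoupled at `n`: the functional
calculus of `h_D` on the sequences that vanish at `n`, and multiplication by `l` on the span of
the unit vector at `n`. It is used with `l = lim_{λ → ∞} f(λ)` (formally, `h_D` has the value
`+∞` at the site `n`); for `f(λ) = (λ - z)⁻¹` this is the extension by zero of the resolvent. -/
def dirichletCalculus (v : ℤ → ℝ) (hv : ∃ C, ∀ m, |v m| ≤ C) (n : ℤ) (f : ℝ → ℝ) (l : ℝ) :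
    SeqSpace →L[ℂ] SeqSpace :=
  (dirichletSpace n).subtypeL ∘L funcCalc f (dirichlet v hv n) ∘L
      (dirichletSpace n).orthogonalProjectionOnto
    + (l : ℂ) • (ℂ ∙ delta n).starProjection

/-- `f(h) - f(h_D)`. -/
def calculusDiff (v : ℤ → ℝ) (hv : ∃ C, ∀ m, |v m| ≤ C) (n : ℤ) (f : ℝ → ℝ) (l : ℝ) :
    SeqSpace →L[ℂ] SeqSpace :=
  funcCalc f (jacobi v hv) - dirichletCalculus v hv n f l

/-- Trace class operators on a Hilbert space, as the nuclear operators: norm-absolutely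
convergent sums of operators of rank at most one. -/
def IsTraceClass {H : Type*} [NormedAddCommGroup H] [InnerProductSpace ℂ H]
    (A : H →L[ℂ] H) : Prop :=
  ∃ x y : ℕ → H, Summable (fun k => ‖x k‖ * ‖y k‖) ∧
    ∀ u : H, HasSum (fun k => ⟪x k, u⟫_ℂ • y k) (A u)

/-- `ξ` is a version of the spectral shift function of the pair `h`, `h_D`, where `h_D` is
decoupled at `n`. -/
structure IsSpectralShift (v : ℤ → ℝ) (hv : ∃ C, ∀ m, |v m| ≤ C) (n : ℤ) (ξ : ℝ → ℝ) :
    Prop where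
  aemeasurable : AEMeasurable ξ
  /-- `tr (f(h) - f(h_D)) = - ∫ f' ξ`, with the trace taken in the standard basis. -/
  trace_formula : ∀ (f : ℝ → ℝ) (l : ℝ), ContDiff ℝ 2 f →
    (∃ C, ∀ t, |(1 + t ^ 2) * deriv f t| ≤ C) → Tendsto f atTop (𝓝 l) →
      IsTraceClass (calculusDiff v hv n f l) ∧
      HasSum (fun m : ℤ => ⟪delta m, calculusDiff v hv n f l (delta m)⟫_ℂ)
        ((-∫ t, deriv f t * ξ t : ℝ) : ℂ)
  mem_Icc : ∀ᵐ t, 0 ≤ ξ t ∧ ξ t ≤ 1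
  eq_zero : ∀ᵐ t, t < sInf (spectrum ℝ (jacobi v hv)) → ξ t = 0

end JacobiTrace

end

/-! Give the decoupled operator the value `0` on `δ_n` instead of `+∞`. This changes `f(h_D)` only
by a multiple of the projection onto `δ_n`, and turns the decoupled operator into `P h P` with `P`
the projection onto `δ_nᗮ`. Then `h - P h P` has rank at most two.

Nuclearity: a `C²` function, cut off and periodized, has Fourier coefficients with `∑ |k| |c_k| <
∞`. Hence `f(A) - f(B) = ∑ a_i(A) (A - B) b_i(B)` with `∑ ‖a_i‖ ‖b_i‖ < ∞`, where the `a_i`, `b_i`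
depend only on `f` and on a bound for the spectra (`exists_operatorLip_of_contDiff`). For `A - B` of
finite rank this difference is nuclear, and its trace is a series of inner products that is
continuous under strong convergence (`tendsto_tsum_inner`).

Existence: for a truncation of `h` to finitely many sites the shift function is a difference of
eigenvalue counting functions plus the indicator of `t ≥ 0`. Cauchy interlacing puts it in `[0, 1]`
(`countLE_sub_countLE_mem_Icc`), and the fundamental theorem of calculus gives the trace formula.
Truncations converge strongly to `h`, so both sides pass to the limit: the traces by the continuity
above, the shift functions by weak compactness in `L²([-R, R])`. The limit is continued by `0` on
the left and by `1` on the right.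

Consequences: every test function is `f'` for an admissible `f`, which gives uniqueness. If `f(t) =
c + a t` on the spectrum of `h`, the trace equals `c + a v(n) - l`, with `l = f(+∞)`. The case `a =
0` shows that `ξ` is `0` below and `1` above the spectrum, and `a = 1` yields the formula for
`v(n)`. -/

namespace JacobiTrace

/-! ### Operator Lipschitz functions: algebraic rules and the exponential -/

/-- The identity function on a set of complex numbers, as a continuous function. -/
noncomputable def idMap (S : Set ℂ) : C(S, ℂ) := .restrict S (.id ℂ)

@[simp] theorem idMap_apply (S : Set ℂ) (z : S) : idMap S z = (z : ℂ) := rfl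

/-- `f(A) - f(B)` is, uniformly in the pair `A`, `B` of elements of a C⋆-algebra with spectrum in
`S`, an absolutely convergent sum of terms `a(A) (A - B) b(B)`, with `∑ ‖a‖ ‖b‖ ≤ c`. -/
def OperatorLip (𝒜 : Type*) [CStarAlgebra 𝒜] {S : Set ℂ} [CompactSpace S]
    (f : C(S, ℂ)) (c : ℝ) : Prop :=
  ∃ a b : ℕ → C(S, ℂ), Summable (fun i => ‖a i‖ * ‖b i‖) ∧ ∑' i, ‖a i‖ * ‖b i‖ ≤ c ∧
    ∀ Φ Ψ : C(S, ℂ) →⋆ₐ[ℂ] 𝒜,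
      HasSum (fun i => Φ (a i) * (Φ (idMap S) - Ψ (idMap S)) * Ψ (b i)) (Φ f - Ψ f)

variable {𝒜 : Type*} [CStarAlgebra 𝒜] {S : Set ℂ} [CompactSpace S]

theorem continuous_starAlgHom (Φ : C(S, ℂ) →⋆ₐ[ℂ] 𝒜) : Continuous Φ :=
  AddMonoidHomClass.continuous_of_bound Φ 1 fun f => by
    simpa using NonUnitalStarAlgHom.norm_apply_le Φ f

theorem norm_term_le (Φ Ψ : C(S, ℂ) →⋆ₐ[ℂ] 𝒜) (a b : C(S, ℂ)) (x : 𝒜) :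
    ‖Φ a * x * Ψ b‖ ≤ ‖a‖ * ‖b‖ * ‖x‖ := by
  have h1 := NonUnitalStarAlgHom.norm_apply_le Φ a
  have h2 := NonUnitalStarAlgHom.norm_apply_le Ψ b
  calc ‖Φ a * x * Ψ b‖ ≤ ‖Φ a‖ * ‖x‖ * ‖Ψ b‖ := norm_mul₃_le
    _ ≤ ‖a‖ * ‖x‖ * ‖b‖ := by gcongr
    _ = _ := by ring

theorem OperatorLip.of_encodable {ι : Type*} [Encodable ι] {f : C(S, ℂ)} (a b : ι → C(S, ℂ))
    (hs : Summable fun i => ‖a i‖ * ‖b i‖)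
    (h : ∀ Φ Ψ : C(S, ℂ) →⋆ₐ[ℂ] 𝒜,
      HasSum (fun i => Φ (a i) * (Φ (idMap S) - Ψ (idMap S)) * Ψ (b i)) (Φ f - Ψ f)) :
    OperatorLip 𝒜 f (∑' i, ‖a i‖ * ‖b i‖) := by
  have hinj : Function.Injective (Encodable.encode : ι → ℕ) := Encodable.encode_injective
  set a' : ℕ → C(S, ℂ) := Function.extend Encodable.encode a 0
  set b' : ℕ → C(S, ℂ) := Function.extend Encodable.encode b 0
  have ha (i : ι) : a' (Encodable.encode i) = a i := hinj.extend_apply ..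
  have hb (i : ι) : b' (Encodable.encode i) = b i := hinj.extend_apply ..
  have h0 (k : ℕ) (hk : k ∉ Set.range (Encodable.encode : ι → ℕ)) : a' k = 0 :=
    Function.extend_apply' _ _ _ (by simpa using hk)
  have hsum : HasSum (fun k => ‖a' k‖ * ‖b' k‖) (∑' i, ‖a i‖ * ‖b i‖) := by
    rw [← hinj.hasSum_iff (fun k hk => by simp [h0 k hk])]
    simpa only [Function.comp_def, ha, hb] using hs.hasSum
  refine ⟨a', b', hsum.summable, hsum.tsum_eq.le, fun Φ Ψ => ?_⟩
  rw [← hinj.hasSum_iff (fun k hk => by simp [h0 k hk])]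
  simpa only [Function.comp_def, ha, hb] using h Φ Ψ

theorem OperatorLip.mono {f : C(S, ℂ)} {c c' : ℝ} (h : OperatorLip 𝒜 f c) (hc : c ≤ c') :
    OperatorLip 𝒜 f c' := by
  obtain ⟨a, b, h1, h2, h3⟩ := h
  exact ⟨a, b, h1, h2.trans hc, h3⟩

theorem OperatorLip.nonneg {f : C(S, ℂ)} {c : ℝ} (h : OperatorLip 𝒜 f c) : 0 ≤ c := by
  obtain ⟨a, b, -, h2, -⟩ := h
  exact le_trans (tsum_nonneg fun i => by positivity) h2

theorem operatorLip_algebraMap (z : ℂ) :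
    OperatorLip 𝒜 (algebraMap ℂ C(S, ℂ) z) 0 := by
  refine ⟨0, 0, by simp, by simp, fun Φ Ψ => ?_⟩
  simp [AlgHomClass.commutes]

theorem operatorLip_idMap : OperatorLip 𝒜 (idMap S) 1 := by
  refine (OperatorLip.of_encodable (ι := Unit) (fun _ => 1) (fun _ => 1) ?_ ?_).mono ?_
  · exact (hasSum_fintype _).summable
  · intro Φ Ψ
    simp
  -- Only an inequality: the norm of `1` is `0` when `S` is empty.
  · have h1 : ‖(1 : C(S, ℂ))‖ ≤ 1 := (ContinuousMap.norm_le _ zero_le_one).2 fun x => by simp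
    rw [tsum_fintype]
    simpa using mul_le_one₀ h1 (norm_nonneg _) h1

/-- Leibniz rule: `f(A) g(A) - f(B) g(B) = f(A) (g(A) - g(B)) + (f(A) - f(B)) g(B)`. -/
theorem OperatorLip.mul {f g : C(S, ℂ)} {c d : ℝ} (hf : OperatorLip 𝒜 f c)
    (hg : OperatorLip 𝒜 g d) : OperatorLip 𝒜 (f * g) (‖f‖ * d + c * ‖g‖) := by
  obtain ⟨a, b, h1, h2, h3⟩ := hf
  obtain ⟨a', b', h1', h2', h3'⟩ := hg
  have hb1 (i : ℕ) : ‖f * a' i‖ * ‖b' i‖ ≤ ‖f‖ * (‖a' i‖ * ‖b' i‖) := by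
    rw [← mul_assoc]; gcongr; exact norm_mul_le _ _
  have hb2 (i : ℕ) : ‖a i‖ * ‖b i * g‖ ≤ (‖a i‖ * ‖b i‖) * ‖g‖ := by
    rw [mul_assoc]; gcongr; exact norm_mul_le _ _
  have hs1 : Summable fun i => ‖f * a' i‖ * ‖b' i‖ :=
    .of_nonneg_of_le (fun _ => by positivity) hb1 (h1'.mul_left _)
  have hs2 : Summable fun i => ‖a i‖ * ‖b i * g‖ :=
    .of_nonneg_of_le (fun _ => by positivity) hb2 (h1.mul_right _)
  have hs := HasSum.sum (f := fun i : ℕ ⊕ ℕ =>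
    ‖Sum.elim (fun i => f * a' i) a i‖ * ‖Sum.elim b' (fun i => b i * g) i‖)
    hs1.hasSum hs2.hasSum
  refine (OperatorLip.of_encodable _ _ hs.summable fun Φ Ψ => ?_).mono (hs.tsum_eq.le.trans ?_)
  · have e1 := (h3' Φ Ψ).mul_left (Φ f)
    have e2 := (h3 Φ Ψ).mul_right (Ψ g)
    have e := HasSum.sum (f := fun i : ℕ ⊕ ℕ => Φ (Sum.elim (fun i => f * a' i) a i) *
      (Φ (idMap S) - Ψ (idMap S)) * Ψ (Sum.elim b' (fun i => b i * g) i))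
      (a := Φ f * (Φ g - Ψ g)) (b := (Φ f - Ψ f) * Ψ g)
      (by simpa [Function.comp_def, mul_assoc] using e1)
      (by simpa [Function.comp_def, mul_assoc] using e2)
    convert e using 1
    simp only [map_mul]
    noncomm_ring
  · refine add_le_add ?_ ?_
    · refine (hs1.tsum_le_tsum hb1 (h1'.mul_left _)).trans ?_
      rw [tsum_mul_left]; gcongr
    · refine (hs2.tsum_le_tsum hb2 (h1.mul_right _)).trans ?_
      rw [tsum_mul_right]; gcongr

theorem OperatorLip.smul {f : C(S, ℂ)} {c : ℝ} (z : ℂ) (hf : OperatorLip 𝒜 f c) :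
    OperatorLip 𝒜 (z • f) (‖z‖ * c) := by
  rw [Algebra.smul_def]
  refine ((operatorLip_algebraMap z).mul hf).mono ?_
  rw [zero_mul, add_zero]
  gcongr
  · exact hf.nonneg
  · exact (ContinuousMap.norm_le _ (norm_nonneg _)).2 fun x => by simp

/-- Iterating the Leibniz rule gives the constant suggested by the derivative of `f ^ m`. For `F =
1` it grows only linearly in `m`, which is what makes Fourier series usable. -/
theorem OperatorLip.pow {f : C(S, ℂ)} {c F : ℝ} (hf : OperatorLip 𝒜 f c) (hF : ‖f‖ ≤ F)
    (m : ℕ) : OperatorLip 𝒜 (f ^ m) (m * (c * F ^ (m - 1))) := by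
  have hF0 : 0 ≤ F := (norm_nonneg _).trans hF
  have hc := hf.nonneg
  have hp : ∀ k : ℕ, 0 < k → ‖f ^ k‖ ≤ F ^ k := fun k hk =>
    (norm_pow_le' f hk).trans (by gcongr)
  induction m with
  | zero => simpa using operatorLip_algebraMap (𝒜 := 𝒜) (S := S) 1
  | succ k ih =>
    rcases Nat.eq_zero_or_pos k with rfl | hk
    · simpa using hf
    · rw [pow_succ]
      refine (ih.mul hf).mono ?_
      have hk' : F ^ k = F ^ (k - 1) * F := by rw [← pow_succ]; congr 1; omega
      calc ‖f ^ k‖ * c + k * (c * F ^ (k - 1)) * ‖f‖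
          ≤ F ^ k * c + k * (c * F ^ (k - 1)) * F := by gcongr; exact hp k hk
        _ = _ := by simp only [Nat.add_sub_cancel, Nat.cast_add, Nat.cast_one, hk']; ring

/-- The families of all terms are merged over `κ × ℕ`. Summability of the constants makes the double
series absolutely convergent, so it can be summed fibrewise. -/
theorem OperatorLip.hasSum {κ : Type*} [Encodable κ] {f : κ → C(S, ℂ)} {g : C(S, ℂ)}
    {c : κ → ℝ} (h : ∀ k, OperatorLip 𝒜 (f k) (c k)) (hc : Summable c) (hg : HasSum f g) :
    OperatorLip 𝒜 g (∑' k, c k) := by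
  choose a b h1 h2 h3 using h
  have hs : Summable fun p : κ × ℕ => ‖a p.1 p.2‖ * ‖b p.1 p.2‖ := by
    rw [summable_prod_of_nonneg (fun p => by positivity)]
    exact ⟨h1, .of_nonneg_of_le (fun k => tsum_nonneg fun i => by positivity) h2 hc⟩
  refine (OperatorLip.of_encodable (ι := κ × ℕ) (fun p => a p.1 p.2) (fun p => b p.1 p.2) hs
    fun Φ Ψ => ?_).mono ?_
  · have hsm : Summable fun p : κ × ℕ =>
        Φ (a p.1 p.2) * (Φ (idMap S) - Ψ (idMap S)) * Ψ (b p.1 p.2) :=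
      .of_norm_bounded (hs.mul_right _) fun p => norm_term_le Φ Ψ _ _ _
    have e1 := hsm.hasSum.prod_fiberwise fun k => h3 k Φ Ψ
    have e2 := (hg.map Φ (continuous_starAlgHom Φ)).sub (hg.map Ψ (continuous_starAlgHom Ψ))
    rw [e2.unique e1]
    exact hsm.hasSum
  · rw [hs.tsum_prod' h1]
    exact Summable.tsum_le_tsum h2 hs.prod hc

theorem exists_operatorLip_exp (z : ℂ) :
    ∃ c, OperatorLip 𝒜 (NormedSpace.exp (z • idMap S)) c := by
  set F := ‖idMap S‖
  have h (m : ℕ) : OperatorLip 𝒜 (((m.factorial : ℂ)⁻¹) • (z • idMap S) ^ m)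
      (‖((m.factorial : ℂ)⁻¹)‖ * (m * (‖z‖ * 1 * (‖z‖ * F) ^ (m - 1)))) :=
    ((operatorLip_idMap.smul z).pow (norm_smul_le z _) m).smul _
  refine ⟨_, OperatorLip.hasSum h ?_ (NormedSpace.exp_series_hasSum_exp' (𝕂 := ℂ) _)⟩
  -- The term `m = 0` is a constant with factor `0`; after the shift, `m / m!` becomes `1 / (m -
  -- 1)!` and the exponential series appears.
  rw [← summable_nat_add_iff 1]
  refine ((Real.summable_pow_div_factorial (‖z‖ * F)).mul_left ‖z‖).congr fun m => ?_
  rw [Nat.factorial_succ]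
  simp only [Nat.cast_mul, norm_inv, norm_mul, Complex.norm_natCast, Nat.add_sub_cancel]
  have h1 : ((m + 1 : ℕ) : ℝ) ≠ 0 := by positivity
  have h2 : ((m.factorial : ℕ) : ℝ) ≠ 0 := by positivity
  field_simp

end JacobiTrace

/-! ### Fourier series: twice continuously differentiable functions are operator Lipschitz -/

namespace JacobiTrace

theorem fourierCoeffOn_deriv_of_eq {a b : ℝ} (hab : a < b) {g : ℝ → ℂ} (hg : ContDiff ℝ 1 g)
    (h0 : g a = g b) {k : ℤ} (hk : k ≠ 0) :
    ‖fourierCoeffOn hab (deriv g) k‖ =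
      2 * Real.pi / (b - a) * (|(k : ℝ)| * ‖fourierCoeffOn hab g k‖) := by
  have hd : Continuous (deriv g) := hg.continuous_deriv le_rfl
  have h := fourierCoeffOn_of_hasDerivAt hab hk
    (fun x _ => (hg.differentiable one_ne_zero x).hasDerivAt) (hd.intervalIntegrable a b)
  have hba : 0 < b - a := sub_pos.2 hab
  rw [h, h0, sub_self, mul_zero, zero_sub, ← Complex.ofReal_sub]
  have hk' : |(k : ℝ)| ≠ 0 := by simpa using hk
  simp only [norm_mul, norm_div, norm_neg, norm_one, Complex.norm_real, Complex.norm_I,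
    Complex.norm_intCast, Complex.norm_two, Real.norm_eq_abs, abs_of_pos hba,
    abs_of_pos Real.pi_pos]
  have := Real.pi_ne_zero
  field_simp

/-- Two integrations by parts without boundary terms turn `|k| |c_k(g)|` into a multiple of
`|c_k(g'')| / |k|`. This is bounded by `|c_k(g'')|² + 1 / k²`, and Parseval for `g''` makes the
bound summable. -/
theorem summable_abs_mul_fourierCoeffOn {a b : ℝ} (hab : a < b) {g : ℝ → ℂ}
    (hg : ContDiff ℝ 2 g) (h0 : g a = g b) (h1 : deriv g a = deriv g b) :
    Summable fun k : ℤ => |(k : ℝ)| * ‖fourierCoeffOn hab g k‖ := by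
  have hg' : ContDiff ℝ 1 (deriv g) := hg.deriv' (n := 1)
  have hba : 0 < b - a := sub_pos.2 hab
  have hc : Continuous (deriv (deriv g)) := hg'.continuous_deriv le_rfl
  have hL2 : MemLp (deriv (deriv g)) 2 (volume.restrict (Set.Ioc a b)) :=
by
    obtain ⟨C, hC⟩ := isCompact_Icc.exists_bound_of_continuousOn (s := Set.Icc a b) hc.continuousOn
    exact MemLp.of_bound hc.aestronglyMeasurable C
      ((ae_restrict_mem measurableSet_Ioc).mono fun x hx => hC x (Set.Ioc_subset_Icc_self hx))
  have hs := (hasSum_sq_fourierCoeffOn hab hL2).summable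
  have hz : Summable fun k : ℤ => 1 / (k : ℝ) ^ 2 := Real.summable_one_div_int_pow.2 one_lt_two
  set M := (b - a) / (2 * Real.pi)
  refine Summable.of_nonneg_of_le (fun k => by positivity) (fun k => ?_)
    ((hs.add hz).mul_left (M ^ 2))
  rcases eq_or_ne k 0 with rfl | hk
  · simp only [Int.cast_zero, abs_zero, zero_mul]; positivity
  have e1 := fourierCoeffOn_deriv_of_eq hab (hg.of_le one_le_two) h0 hk
  have e2 := fourierCoeffOn_deriv_of_eq hab hg' h1 hk
  have hk' : 0 < |(k : ℝ)| := by simpa using hk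
  have hpi := Real.pi_pos
  set p := ‖fourierCoeffOn hab g k‖
  set q := ‖fourierCoeffOn hab (deriv (deriv g)) k‖
  have e3 : |(k : ℝ)| * p = M ^ 2 * (q * |(k : ℝ)|⁻¹) := by
    rw [e2, e1]; simp only [M]; field_simp
  have hsq : ((k : ℝ) ^ 2) = |(k : ℝ)| ^ 2 := (sq_abs _).symm
  rw [e3, hsq, one_div, ← inv_pow]
  gcongr
  nlinarith [sq_nonneg (q - |(k : ℝ)|⁻¹), sq_nonneg (q + |(k : ℝ)|⁻¹)]

theorem hasSum_fourierCoeffOn_mul_exp {a b : ℝ} (hab : a < b) {g : ℝ → ℂ}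
    (hg : Continuous g) (h0 : g a = g b)
    (hs : Summable fun k : ℤ => |(k : ℝ)| * ‖fourierCoeffOn hab g k‖) {x : ℝ}
    (hx : x ∈ Set.Ioc a b) :
    HasSum (fun k : ℤ => fourierCoeffOn hab g k *
      Complex.exp (2 * Real.pi * Complex.I * k * x / ((b - a : ℝ) : ℂ))) (g x) := by
  have := Fact.mk (by linarith : 0 < b - a)
  have e : a + (b - a) = b := by ring
  set G : C(AddCircle (b - a), ℂ) := ⟨AddCircle.liftIoc (b - a) a g,
    AddCircle.liftIoc_continuous (by rwa [e]) hg.continuousOn⟩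
  have hcoef (k : ℤ) : fourierCoeff G k = fourierCoeffOn hab g k := rfl
  have hsum : Summable (fourierCoeff G) := by
    refine Summable.of_norm_bounded_eventually hs ?_
    filter_upwards [(Set.finite_singleton (0 : ℤ)).compl_mem_cofinite] with k hk
    have hk1 : (1 : ℝ) ≤ |(k : ℝ)| := by exact_mod_cast Int.one_le_abs hk
    rw [hcoef]
    exact le_mul_of_one_le_left (norm_nonneg _) hk1
  have h := has_pointwise_sum_fourier_series_of_summable hsum (x : AddCircle (b - a))
  have hGx : G x = g x := AddCircle.liftIoc_coe_apply (by rwa [e])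
  rw [hGx] at h
  simpa only [hcoef, fourier_coe_apply, smul_eq_mul] using h

/-- The interval `[-R, R]` as a set of complex numbers. -/
def realSeg (R : ℝ) : Set ℂ := Complex.ofReal '' Set.Icc (-R) R

instance (R : ℝ) : CompactSpace (realSeg R) :=
  isCompact_iff_compactSpace.1 (isCompact_Icc.image Complex.continuous_ofReal)

theorem mem_realSeg {R : ℝ} (z : realSeg R) :
    (z : ℂ).re ∈ Set.Icc (-R) R ∧ ((z : ℂ).re : ℂ) = z := by
  obtain ⟨_, x, hx, rfl⟩ := z
  simpa using hx

/-- A real function as a complex continuous function on `[-R, R]`. -/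
noncomputable def realMap (R : ℝ) (f : C(ℝ, ℝ)) : C(realSeg R, ℂ) :=
  ⟨fun z => (f (z : ℂ).re : ℂ), by fun_prop⟩

@[simp] theorem realMap_apply (R : ℝ) (f : C(ℝ, ℝ)) (z : realSeg R) :
    realMap R f z = (f (z : ℂ).re : ℂ) := rfl

theorem exp_smul_idMap_apply {S : Set ℂ} [CompactSpace S] (z : ℂ) (x : S) :
    NormedSpace.exp (z • idMap S) x = Complex.exp (z * x) := by
  have h := NormedSpace.map_exp
    ((Pi.evalRingHom (fun _ : S => ℂ) x).comp ContinuousMap.coeFnRingHom : C(S, ℂ) →+* ℂ)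
    (continuous_eval_const x) (z • idMap S)
  rw [Complex.exp_eq_exp_ℂ]
  exact h

variable {𝒜 : Type*} [CStarAlgebra 𝒜]

theorem norm_exp_smul_idMap_le (R t : ℝ) :
    ‖NormedSpace.exp ((t * Complex.I) • idMap (realSeg R))‖ ≤ 1 := by
  refine (ContinuousMap.norm_le _ zero_le_one).2 fun z => ?_
  rw [exp_smul_idMap_apply, ← (mem_realSeg z).2, mul_right_comm, ← Complex.ofReal_mul,
    Complex.norm_exp_ofReal_mul_I]

/-- The exponential of frequency `k ω` is a power of the one of frequency `± ω`, which has modulus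
at most one on real arguments. So the constant is linear in `|k|`, whereas the power series alone
would give exponential growth. -/
theorem exists_operatorLip_cexp (R ω : ℝ) : ∃ c, ∀ k : ℤ,
    OperatorLip 𝒜 (NormedSpace.exp ((k * (ω * Complex.I)) • idMap (realSeg R)))
      (|(k : ℝ)| * c) := by
  obtain ⟨c₁, h₁⟩ := exists_operatorLip_exp (𝒜 := 𝒜) (S := realSeg R) (((ω : ℝ) : ℂ) * Complex.I)
  obtain ⟨c₂, h₂⟩ := exists_operatorLip_exp (𝒜 := 𝒜) (S := realSeg R) (((-ω : ℝ) : ℂ) * Complex.I)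
  have key (m : ℕ) (t : ℝ) (c : ℝ)
      (h : OperatorLip 𝒜 (NormedSpace.exp ((t * Complex.I) • idMap (realSeg R))) c) :
      OperatorLip 𝒜 (NormedSpace.exp ((m * (t * Complex.I)) • idMap (realSeg R))) (m * c) := by
    have e : NormedSpace.exp ((m * (t * Complex.I)) • idMap (realSeg R)) =
        NormedSpace.exp ((t * Complex.I) • idMap (realSeg R)) ^ m := by
      ext z
      rw [ContinuousMap.pow_apply, exp_smul_idMap_apply, exp_smul_idMap_apply,
        ← Complex.exp_nat_mul]
      ring_nf
    rw [e]
    simpa using h.pow (norm_exp_smul_idMap_le R t) m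
  refine ⟨max c₁ c₂, fun k => ?_⟩
  obtain ⟨m, rfl | rfl⟩ := k.eq_nat_or_neg
  · have h := key m ω c₁ h₁
    refine (by simpa using h : OperatorLip 𝒜 _ (m * c₁)).mono ?_
    rw [Int.cast_natCast, Nat.abs_cast]
    gcongr
    exact le_max_left _ _
  · have h := key m (-ω) c₂ h₂
    refine (by simpa using h : OperatorLip 𝒜 _ (m * c₂)).mono ?_
    rw [Int.cast_neg, abs_neg, Int.cast_natCast, Nat.abs_cast]
    gcongr
    exact le_max_right _ _

/-- `C²` functions are operator Lipschitz. -/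
theorem exists_operatorLip_of_contDiff {R : ℝ} (hR : 0 < R) (f : C(ℝ, ℝ)) (hf : ContDiff ℝ 2 f) :
    ∃ c, OperatorLip 𝒜 (realMap R f) c := by
  -- The cutoff is `1` on `[-R, R]` and `0` beyond `2R`, so on the period `[-3R, 3R]` the product
  -- vanishes near both ends and the values and derivatives there match.
  set χ : ContDiffBump (0 : ℝ) := ⟨R, 2 * R, hR, by linarith⟩
  set g : ℝ → ℂ := fun x => ((χ x * f x : ℝ) : ℂ)
  have hg : ContDiff ℝ 2 g := Complex.ofRealCLM.contDiff.comp (χ.contDiff.mul hf)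
  have hz (x : ℝ) (hx : 2 * R < |x|) : g =ᶠ[𝓝 x] fun _ => 0 := by
    have : ∀ᶠ y in 𝓝 x, 2 * R < |y| := continuous_abs.continuousAt.eventually (lt_mem_nhds hx)
    filter_upwards [this] with y hy
    have : χ y = 0 := χ.zero_of_le_dist (by simpa using hy.le)
    simp [g, this]
  have hab : -(3 * R) < 3 * R := by linarith
  have hza := hz (-(3 * R)) (by rw [abs_neg, abs_of_pos] <;> linarith)
  have hzb := hz (3 * R) (by rw [abs_of_pos] <;> linarith)
  have h0 : g (-(3 * R)) = g (3 * R) := by rw [hza.eq_of_nhds, hzb.eq_of_nhds]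
  have h1 : deriv g (-(3 * R)) = deriv g (3 * R) := by rw [hza.deriv_eq, hzb.deriv_eq]; simp
  have hs := summable_abs_mul_fourierCoeffOn hab hg h0 h1
  obtain ⟨ω, hω⟩ : ∃ ω, ω = 2 * Real.pi / (3 * R - -(3 * R)) := ⟨_, rfl⟩
  obtain ⟨c, hc⟩ := exists_operatorLip_cexp (𝒜 := 𝒜) R ω
  obtain ⟨E, hEdef⟩ : ∃ E : ℤ → C(realSeg R, ℂ), ∀ k,
      E k = NormedSpace.exp ((k * (ω * Complex.I)) • idMap (realSeg R)) := ⟨_, fun _ => rfl⟩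
  have hE (k : ℤ) : ‖E k‖ ≤ 1 := by
    have := norm_exp_smul_idMap_le R (k * ω)
    rwa [hEdef, ← mul_assoc, ← Complex.ofReal_intCast, ← Complex.ofReal_mul]
  simp only [← hEdef] at hc
  have hlip (k : ℤ) := (hc k).smul (fourierCoeffOn hab g k)
  have hpt (z : realSeg R) :
      HasSum (fun k => (fourierCoeffOn hab g k • E k) z) (realMap R f z) := by
    obtain ⟨hz1, hz2⟩ := mem_realSeg z
    have hx : (z : ℂ).re ∈ Set.Ioc (-(3 * R)) (3 * R) := ⟨by linarith [hz1.1], by linarith [hz1.2]⟩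
    have h := hasSum_fourierCoeffOn_mul_exp hab hg.continuous h0 hs hx
    have hgz : g (z : ℂ).re = realMap R f z := by
      have : χ (z : ℂ).re = 1 := χ.one_of_mem_closedBall (by
        simpa [abs_le] using hz1)
      simp [g, this]
    rw [hgz] at h
    convert h using 2 with k
    rw [ContinuousMap.smul_apply, hEdef, exp_smul_idMap_apply, ← hz2, hω, smul_eq_mul]
    congr 2
    push_cast [Complex.ofReal_re]
    ring
  have hsm : Summable fun k => fourierCoeffOn hab g k • E k := by
    refine Summable.of_norm_bounded_eventually hs ?_
    filter_upwards [(Set.finite_singleton (0 : ℤ)).compl_mem_cofinite] with k hk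
    have hk1 : (1 : ℝ) ≤ |(k : ℝ)| := by exact_mod_cast Int.one_le_abs hk
    calc ‖fourierCoeffOn hab g k • E k‖ ≤ ‖fourierCoeffOn hab g k‖ * ‖E k‖ := norm_smul_le _ _
      _ ≤ ‖fourierCoeffOn hab g k‖ * 1 := by gcongr; exact hE k
      _ ≤ _ := by rw [mul_one]; exact le_mul_of_one_le_left (norm_nonneg _) hk1
  -- The series converges in norm; its sum is identified by evaluation at points.
  have hsum : HasSum (fun k => fourierCoeffOn hab g k • E k) (realMap R f) := by
    obtain ⟨F, hF⟩ := hsm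
    have hFf : F = realMap R f := by
      ext z
      exact (hF.map (ContinuousMap.evalCLM ℂ z : C(realSeg R, ℂ) →L[ℂ] ℂ)
        (ContinuousMap.evalCLM ℂ z).continuous).unique (hpt z)
    rwa [hFf] at hF
  refine ⟨_, OperatorLip.hasSum hlip ?_ hsum⟩
  exact (hs.mul_right c).congr fun k => by ring

end JacobiTrace

/-! ### Nuclear traces and their continuity under strong convergence -/

namespace JacobiTrace

variable {H : Type*} [NormedAddCommGroup H] [InnerProductSpace ℂ H]

/-- `T` is nuclear and `τ` is its trace. -/
def HasNuclearTrace (T : H →L[ℂ] H) (τ : ℂ) : Prop :=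
  ∃ x y : ℕ → H, Summable (fun k => ‖x k‖ * ‖y k‖) ∧
    (∀ u : H, HasSum (fun k => ⟪x k, u⟫_ℂ • y k) (T u)) ∧ HasSum (fun k => ⟪x k, y k⟫_ℂ) τ

theorem HasNuclearTrace.isTraceClass {T : H →L[ℂ] H} {τ : ℂ} (h : HasNuclearTrace T τ) :
    IsTraceClass T := by
  obtain ⟨x, y, h1, h2, -⟩ := h
  exact ⟨x, y, h1, h2⟩

theorem HasNuclearTrace.of_encodable {ι : Type*} [Encodable ι] {T : H →L[ℂ] H} {τ : ℂ}
    (x y : ι → H) (h1 : Summable fun k => ‖x k‖ * ‖y k‖)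
    (h2 : ∀ u : H, HasSum (fun k => ⟪x k, u⟫_ℂ • y k) (T u))
    (h3 : HasSum (fun k => ⟪x k, y k⟫_ℂ) τ) : HasNuclearTrace T τ := by
  have hinj : Function.Injective (Encodable.encode : ι → ℕ) := Encodable.encode_injective
  obtain ⟨x', hx'⟩ : ∃ x' : ℕ → H, x' = Function.extend Encodable.encode x 0 := ⟨_, rfl⟩
  obtain ⟨y', hy'⟩ : ∃ y' : ℕ → H, y' = Function.extend Encodable.encode y 0 := ⟨_, rfl⟩
  have ha (i : ι) : x' (Encodable.encode i) = x i := by rw [hx', hinj.extend_apply]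
  have hb (i : ι) : y' (Encodable.encode i) = y i := by rw [hy', hinj.extend_apply]
  have h0 (k : ℕ) (hk : k ∉ Set.range (Encodable.encode : ι → ℕ)) : y' k = 0 := by
    rw [hy', Function.extend_apply' _ _ _ (by simpa using hk), Pi.zero_apply]
  refine ⟨x', y', ?_, fun u => ?_, ?_⟩
  · rw [← hinj.summable_iff (fun k hk => by simp [h0 k hk])]
    simpa only [Function.comp_def, ha, hb] using h1
  · rw [← hinj.hasSum_iff (fun k hk => by simp [h0 k hk])]
    simpa only [Function.comp_def, ha, hb] using h2 u
  · rw [← hinj.hasSum_iff (fun k hk => by simp [h0 k hk])]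
    simpa only [Function.comp_def, ha, hb] using h3

theorem HasNuclearTrace.add {T T' : H →L[ℂ] H} {τ τ' : ℂ} (h : HasNuclearTrace T τ)
    (h' : HasNuclearTrace T' τ') : HasNuclearTrace (T + T') (τ + τ') := by
  obtain ⟨x, y, h1, h2, h3⟩ := h
  obtain ⟨x', y', h1', h2', h3'⟩ := h'
  exact .of_encodable (Sum.elim x x') (Sum.elim y y') (Summable.sum _ h1 h1')
    (fun u => HasSum.sum (h2 u) (h2' u)) (HasSum.sum h3 h3')

theorem hasNuclearTrace_rankOne (x y : H) :
    HasNuclearTrace (InnerProductSpace.rankOne ℂ y x) ⟪x, y⟫_ℂ :=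
  .of_encodable (ι := Unit) (fun _ => x) (fun _ => y) (hasSum_fintype _).summable
    (fun u => by simp)
    (by simp)

theorem sum_norm_inner_mul_norm_inner_le {κ : Type*} {b : κ → H} (hb : Orthonormal ℂ b) (x y : H)
    (s : Finset κ) : ∑ m ∈ s, ‖⟪x, b m⟫_ℂ‖ * ‖⟪b m, y⟫_ℂ‖ ≤ ‖x‖ * ‖y‖ := by
  refine (Real.sum_mul_le_sqrt_mul_sqrt _ _ _).trans ?_
  gcongr
  · rw [Real.sqrt_le_left (norm_nonneg _)]
    simpa only [norm_inner_symm x] using hb.sum_inner_products_le x (s := s)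
  · rw [Real.sqrt_le_left (norm_nonneg _)]
    exact hb.sum_inner_products_le y (s := s)

/-- The double series of `⟪x k, b m⟫ ⟪b m, y k⟫` converges absolutely by Cauchy–Schwarz and Bessel.
Summing over `m` first is Parseval and gives `τ`; summing over `k` first gives the diagonal entries
of `T`. -/
theorem HasNuclearTrace.hasSum_inner {κ : Type*} (b : HilbertBasis κ ℂ H) {T : H →L[ℂ] H}
    {τ : ℂ} (h : HasNuclearTrace T τ) : HasSum (fun m => ⟪b m, T (b m)⟫_ℂ) τ := by
  obtain ⟨x, y, h1, h2, h3⟩ := h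
  have hle := fun i => sum_norm_inner_mul_norm_inner_le b.orthonormal (x i) (y i)
  have hs : Summable fun p : ℕ × κ => ‖⟪x p.1, b p.2⟫_ℂ‖ * ‖⟪b p.2, y p.1⟫_ℂ‖ := by
    rw [summable_prod_of_nonneg (fun p => by positivity)]
    refine ⟨fun i => summable_of_sum_le (fun m => by positivity) (hle i),
      .of_nonneg_of_le (fun i => tsum_nonneg fun m => by positivity) (fun i => ?_) h1⟩
    exact Real.tsum_le_of_sum_le (fun m => by positivity) (hle i)
  have hsum : Summable fun p : ℕ × κ => ⟪x p.1, b p.2⟫_ℂ * ⟪b p.2, y p.1⟫_ℂ :=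
    .of_norm (by simpa only [norm_mul] using hs)
  have e1 := hsum.hasSum.prod_fiberwise fun i => b.hasSum_inner_mul_inner (x i) (y i)
  have e2 := ((Equiv.prodComm κ ℕ).hasSum_iff.2 hsum.hasSum).prod_fiberwise fun m => by
    simpa [Function.comp_def, inner_smul_right] using
      (h2 (b m)).mapL (innerSL ℂ (b m))
  rwa [e1.unique h3] at e2

section Series

variable [CompleteSpace H] {S : Set ℂ} [CompactSpace S]

/-- Each term has rank at most one, built from the vectors `Ψ(b i)* x` and `Φ(a i) y`. The trace
thus involves the representations only through their action on vectors, which suits strong limits.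
-/
theorem hasNuclearTrace_tsum (Φ Ψ : C(S, ℂ) →⋆ₐ[ℂ] (H →L[ℂ] H)) {a b : ℕ → C(S, ℂ)}
    (hab : Summable fun i => ‖a i‖ * ‖b i‖) (x y : H) :
    HasNuclearTrace (∑' i, Φ (a i) * InnerProductSpace.rankOne ℂ y x * Ψ (b i))
      (∑' i, ⟪Ψ (star (b i)) x, Φ (a i) y⟫_ℂ) := by
  have hΦ (f : C(S, ℂ)) (u : H) : ‖Φ f u‖ ≤ ‖f‖ * ‖u‖ :=
    (ContinuousLinearMap.le_opNorm _ _).trans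
      (by gcongr; exact NonUnitalStarAlgHom.norm_apply_le Φ f)
  have hΨ (f : C(S, ℂ)) (u : H) : ‖Ψ (star f) u‖ ≤ ‖f‖ * ‖u‖ :=
    (ContinuousLinearMap.le_opNorm _ _).trans
      (by gcongr; simpa using NonUnitalStarAlgHom.norm_apply_le Ψ (star f))
  have hs : Summable fun i => ‖Ψ (star (b i)) x‖ * ‖Φ (a i) y‖ := by
    refine .of_nonneg_of_le (fun i => by positivity) (fun i => ?_) (hab.mul_left (‖x‖ * ‖y‖))
    calc _ ≤ (‖b i‖ * ‖x‖) * (‖a i‖ * ‖y‖) := by gcongr; exacts [hΨ _ _, hΦ _ _]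
      _ = _ := by ring
  refine ⟨fun i => Ψ (star (b i)) x, fun i => Φ (a i) y, hs, fun u => ?_, ?_⟩
  · have hsm : Summable fun i => Φ (a i) * InnerProductSpace.rankOne ℂ y x * Ψ (b i) :=
      .of_norm_bounded (hab.mul_right _) fun i => norm_term_le Φ Ψ _ _ _
    have h := hsm.hasSum.mapL (ContinuousLinearMap.apply ℂ H u)
    convert h using 2 with i
    · simp [map_star, ContinuousLinearMap.star_eq_adjoint, ContinuousLinearMap.adjoint_inner_left]
    · rfl
  · exact (Summable.of_norm_bounded hs fun i => norm_inner_le_norm _ _).hasSum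

theorem tendsto_starAlgHom_apply_of_tendsto {ι : Type*} {l : Filter ι}
    {Φ : ι → C(S, ℂ) →⋆ₐ[ℂ] (H →L[ℂ] H)} {Φ₀ : C(S, ℂ) →⋆ₐ[ℂ] (H →L[ℂ] H)} {g : C(S, ℂ)}
    (h : ∀ u, Tendsto (fun i => Φ i g u) l (𝓝 (Φ₀ g u))) {z : ι → H} {z₀ : H}
    (hz : Tendsto z l (𝓝 z₀)) : Tendsto (fun i => Φ i g (z i)) l (𝓝 (Φ₀ g z₀)) := by
  have h0 : Tendsto (fun i => Φ i g (z i - z₀)) l (𝓝 0) := by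
    refine squeeze_zero_norm (a := fun i => ‖g‖ * ‖z i - z₀‖) (fun i => ?_) ?_
    · exact (ContinuousLinearMap.le_opNorm _ _).trans
        (by gcongr; exact NonUnitalStarAlgHom.norm_apply_le (Φ i) g)
    · simpa using (tendsto_iff_norm_sub_tendsto_zero.1 hz).const_mul ‖g‖
  simpa using h0.add (h z₀)

/-- Traces are not strongly continuous in general, but here dominated convergence applies:
representations are contractive, so the terms are bounded by a multiple of `‖a k‖ ‖b k‖` uniformly
in `i`. -/
theorem tendsto_tsum_inner {ι : Type*} {l : Filter ι}
    {Φ Ψ : ι → C(S, ℂ) →⋆ₐ[ℂ] (H →L[ℂ] H)} {Φ₀ Ψ₀ : C(S, ℂ) →⋆ₐ[ℂ] (H →L[ℂ] H)}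
    (hΦ : ∀ g u, Tendsto (fun i => Φ i g u) l (𝓝 (Φ₀ g u)))
    (hΨ : ∀ g u, Tendsto (fun i => Ψ i g u) l (𝓝 (Ψ₀ g u)))
    {a b : ℕ → C(S, ℂ)} (hab : Summable fun i => ‖a i‖ * ‖b i‖) {x y : ι → H} {x₀ y₀ : H}
    (hx : Tendsto x l (𝓝 x₀)) (hy : Tendsto y l (𝓝 y₀)) :
    Tendsto (fun i => ∑' k, ⟪Ψ i (star (b k)) (x i), Φ i (a k) (y i)⟫_ℂ) l
      (𝓝 (∑' k, ⟪Ψ₀ (star (b k)) x₀, Φ₀ (a k) y₀⟫_ℂ)) := by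
  have hbx : ∀ᶠ i in l, ‖x i‖ ≤ ‖x₀‖ + 1 :=
    (hx.norm.eventually (gt_mem_nhds (lt_add_one _))).mono fun _ h => h.le
  have hby : ∀ᶠ i in l, ‖y i‖ ≤ ‖y₀‖ + 1 :=
    (hy.norm.eventually (gt_mem_nhds (lt_add_one _))).mono fun _ h => h.le
  refine tendsto_tsum_of_dominated_convergence (hab.mul_left ((‖x₀‖ + 1) * (‖y₀‖ + 1)))
    (fun k => (tendsto_starAlgHom_apply_of_tendsto (hΨ _) hx).inner
      (tendsto_starAlgHom_apply_of_tendsto (hΦ _) hy)) ?_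
  filter_upwards [hbx, hby] with i h1 h2 k
  have e1 : ‖Ψ i (star (b k)) (x i)‖ ≤ ‖b k‖ * (‖x₀‖ + 1) :=
    (ContinuousLinearMap.le_opNorm _ _).trans
      (by gcongr; simpa using NonUnitalStarAlgHom.norm_apply_le (Ψ i) (star (b k)))
  have e2 : ‖Φ i (a k) (y i)‖ ≤ ‖a k‖ * (‖y₀‖ + 1) :=
    (ContinuousLinearMap.le_opNorm _ _).trans
      (by gcongr; exact NonUnitalStarAlgHom.norm_apply_le (Φ i) (a k))
  calc _ ≤ ‖Ψ i (star (b k)) (x i)‖ * ‖Φ i (a k) (y i)‖ := norm_inner_le_norm _ _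
    _ ≤ (‖b k‖ * (‖x₀‖ + 1)) * (‖a k‖ * (‖y₀‖ + 1)) := by gcongr
    _ = _ := by ring

/-- Star homomorphisms of `C(S, ℂ)` converge strongly as soon as they do at the identity of `S`. -/
theorem tendsto_starAlgHom_apply {ι : Type*} {l : Filter ι}
    {Φ : ι → C(S, ℂ) →⋆ₐ[ℂ] (H →L[ℂ] H)} {Φ₀ : C(S, ℂ) →⋆ₐ[ℂ] (H →L[ℂ] H)}
    (hS : star (idMap S) = idMap S)
    (h : ∀ u, Tendsto (fun i => Φ i (idMap S) u) l (𝓝 (Φ₀ (idMap S) u))) (g : C(S, ℂ)) (u : H) :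
    Tendsto (fun i => Φ i g u) l (𝓝 (Φ₀ g u)) := by
  -- Stone–Weierstrass: convergence passes from the identity to the star algebra it generates, and
  -- then to its closure because representations are contractive.
  induction g using ContinuousMap.induction_on_of_compact generalizing u with
  | const r =>
    have e (Θ : C(S, ℂ) →⋆ₐ[ℂ] (H →L[ℂ] H)) :
        Θ (.const S r) = algebraMap ℂ (H →L[ℂ] H) r := AlgHomClass.commutes Θ r
    simp only [e]
    exact tendsto_const_nhds
  | id => exact h u
  | star_id =>
    change Tendsto (fun i => Φ i (star (idMap S)) u) l (𝓝 (Φ₀ (star (idMap S)) u))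
    rw [hS]; exact h u
  | add f g hf hg => simpa using (hf u).add (hg u)
  | mul f g hf hg =>
    simpa using tendsto_starAlgHom_apply_of_tendsto hf (hg u)
  | frequently f hf =>
    rw [Metric.tendsto_nhds]
    intro ε hε
    have hd : ∀ᶠ g in 𝓝 f, ‖f - g‖ * ‖u‖ < ε / 3 := by
      have : Tendsto (fun g : C(S, ℂ) => ‖f - g‖ * ‖u‖) (𝓝 f) (𝓝 (‖f - f‖ * ‖u‖)) :=
        Continuous.tendsto (by fun_prop) f
      rw [sub_self, norm_zero, zero_mul] at this
      exact this.eventually (gt_mem_nhds (by positivity))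
    obtain ⟨g, hg, hgf⟩ := (hf.and_eventually hd).exists
    have hb (Θ : C(S, ℂ) →⋆ₐ[ℂ] (H →L[ℂ] H)) : dist (Θ f u) (Θ g u) < ε / 3 := by
      rw [dist_eq_norm, ← sub_apply, ← map_sub]
      refine lt_of_le_of_lt ((ContinuousLinearMap.le_opNorm _ _).trans ?_) hgf
      gcongr; exact NonUnitalStarAlgHom.norm_apply_le Θ _
    filter_upwards [Metric.tendsto_nhds.1 (hg u) (ε / 3) (by positivity)] with i hi
    have h1 := hb (Φ i)
    have h2 := hb Φ₀
    rw [dist_comm] at h2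
    calc _ ≤ dist (Φ i f u) (Φ i g u) + dist (Φ i g u) (Φ₀ g u) + dist (Φ₀ g u) (Φ₀ f u) :=
          dist_triangle4 _ _ _ _
      _ < ε := by linarith

theorem starAlgHom_apply_eigenvector (Φ : C(S, ℂ) →⋆ₐ[ℂ] (H →L[ℂ] H))
    (hS : star (idMap S) = idMap S) {z : S} {u : H} (hu : Φ (idMap S) u = (z : ℂ) • u)
    (g : C(S, ℂ)) : Φ g u = g z • u := by
  induction g using ContinuousMap.induction_on_of_compact with
  | const r =>
    have e : Φ (.const S r) = algebraMap ℂ (H →L[ℂ] H) r := AlgHomClass.commutes Φ r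
    rw [e]; rfl
  | id => exact hu
  | star_id =>
    change Φ (star (idMap S)) u = (star (idMap S)) z • u
    rw [hS]; exact hu
  | add f g hf hg => simp [hf, hg, add_smul]
  | mul f g hf hg =>
    rw [map_mul]
    change Φ f (Φ g u) = (f z * g z) • u
    rw [hg, map_smul, hf, smul_smul, mul_comm]
  | frequently f hf =>
    have h1 : Continuous fun f : C(S, ℂ) => Φ f u :=
      (ContinuousLinearMap.apply ℂ H u).continuous.comp (continuous_starAlgHom Φ)
    have h2 : Continuous fun f : C(S, ℂ) => f z • u :=
      (ContinuousLinearMap.toSpanSingleton ℂ u).continuous.comp (continuous_eval_const z)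
    have hc : IsClosed {f : C(S, ℂ) | Φ f u = f z • u} := isClosed_eq h1 h2
    exact hc.mem_of_frequently_of_tendsto hf tendsto_id

end Series

end JacobiTrace

/-! ### Eigenvalue counting functions and interlacing in finite dimension -/

namespace JacobiTrace

section Interlacing

variable {E : Type*} [NormedAddCommGroup E] [InnerProductSpace ℂ E]
  {ι ι' : Type*} [Fintype ι] [Fintype ι']

theorem re_inner_eq_sum_eigenvalues {T : E →ₗ[ℂ] E} (hT : T.IsSymmetric)
    (b : OrthonormalBasis ι ℂ E) {eig : ι → ℝ} (hb : ∀ i, T (b i) = (eig i : ℂ) • b i) (x : E) :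
    (⟪x, T x⟫_ℂ).re = ∑ i, eig i * ‖⟪b i, x⟫_ℂ‖ ^ 2 := by
  rw [← b.sum_inner_mul_inner x (T x), Complex.re_sum]
  refine Finset.sum_congr rfl fun i _ => ?_
  rw [← hT, hb, inner_smul_left, Complex.conj_ofReal, mul_left_comm, ← inner_conj_symm x (b i),
    ← Complex.normSq_eq_conj_mul_self, ← Complex.ofReal_mul, Complex.ofReal_re,
    Complex.normSq_eq_norm_sq]

theorem finrank_le_card_of_forall_inner_eq_zero (b : OrthonormalBasis ι ℂ E) (p : ι → Prop)
    [DecidablePred p] {W : Submodule ℂ E}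
    (h : ∀ x ∈ W, (∀ i, p i → ⟪b i, x⟫_ℂ = 0) → x = 0) :
    Module.finrank ℂ W ≤ Fintype.card {i // p i} := by
  have : FiniteDimensional ℂ E := b.toBasis.finiteDimensional_of_finite
  set L : W →ₗ[ℂ] ({i // p i} → ℂ) :=
    LinearMap.pi fun i => (innerₛₗ ℂ (b i)).comp W.subtype
  have hL : Function.Injective L := by
    rw [injective_iff_map_eq_zero]
    intro x hx
    have := h x x.2 fun i hi => congrFun hx ⟨i, hi⟩
    exact Subtype.ext this
  simpa using LinearMap.finrank_le_finrank_of_injective hL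

theorem finrank_span_eigenvectors (b : OrthonormalBasis ι ℂ E) (p : ι → Prop) [DecidablePred p] :
    Module.finrank ℂ (Submodule.span ℂ (Set.range fun i : {i // p i} => b i)) =
      Fintype.card {i // p i} :=
  finrank_span_eq_card (b.orthonormal.linearIndependent.comp _ Subtype.val_injective)

theorem inner_eq_zero_of_mem_span_eigenvectors (b : OrthonormalBasis ι ℂ E) {p : ι → Prop}
    {x : E} (hx : x ∈ Submodule.span ℂ (Set.range fun i : {i // p i} => b i)) {j : ι}
    (hj : ¬ p j) : ⟪b j, x⟫_ℂ = 0 := by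
  have : Submodule.span ℂ (Set.range fun i : {i // p i} => b i) ≤ (ℂ ∙ b j)ᗮ := by
    rw [Submodule.span_le]
    rintro _ ⟨i, rfl⟩
    refine Submodule.mem_orthogonal_singleton_iff_inner_right.2 (b.orthonormal.2 ?_)
    rintro rfl
    exact hj i.2
  exact Submodule.mem_orthogonal_singleton_iff_inner_right.1 (this hx)

theorem finrank_le_finrank_inf_orthogonal_add_one [FiniteDimensional ℂ E] (V : Submodule ℂ E)
    (d : E) : Module.finrank ℂ V ≤ Module.finrank ℂ (V ⊓ (ℂ ∙ d)ᗮ : Submodule ℂ E) + 1 := by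
  have h1 := Submodule.finrank_sup_add_finrank_inf_eq V (ℂ ∙ d)ᗮ
  have h2 := Submodule.finrank_add_finrank_orthogonal (ℂ ∙ d)
  have h3 : Module.finrank ℂ (ℂ ∙ d) ≤ 1 := (finrank_span_le_card {d}).trans (by simp)
  have h4 := Submodule.finrank_le (V ⊔ (ℂ ∙ d)ᗮ)
  omega

variable {A B : E →ₗ[ℂ] E} (hA : A.IsSymmetric) (hB : B.IsSymmetric)
  (b : OrthonormalBasis ι ℂ E) (b' : OrthonormalBasis ι' ℂ E) {eig : ι → ℝ} {eig' : ι' → ℝ}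
  (hb : ∀ i, A (b i) = (eig i : ℂ) • b i) (hb' : ∀ i, B (b' i) = (eig' i : ℂ) • b' i)

include hA hB hb hb'

/-- Min-max argument: on `W` the common quadratic form is at most `t ‖x‖²`, whereas a nonzero vector
without components along the eigenvectors of `A` with eigenvalue at most `t` has form larger than `t
‖x‖²`. So those components determine the vectors of `W`. -/
theorem finrank_le_card_le {W : Submodule ℂ E} {t : ℝ}
    (hW : W ≤ Submodule.span ℂ (Set.range fun i : {i // eig' i ≤ t} => b' i))
    (hAB : ∀ x ∈ W, ⟪x, A x⟫_ℂ = ⟪x, B x⟫_ℂ) :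
    Module.finrank ℂ W ≤ Fintype.card {i // eig i ≤ t} := by
  refine finrank_le_card_of_forall_inner_eq_zero b _ fun x hx h0 => ?_
  have e := congrArg Complex.re (hAB x hx)
  rw [re_inner_eq_sum_eigenvalues hA b hb, re_inner_eq_sum_eigenvalues hB b' hb'] at e
  have h1 : ∑ i, eig' i * ‖⟪b' i, x⟫_ℂ‖ ^ 2 ≤ ∑ i, t * ‖⟪b' i, x⟫_ℂ‖ ^ 2 := by
    refine Finset.sum_le_sum fun i _ => ?_
    by_cases hi : eig' i ≤ t
    · gcongr
    · simp [inner_eq_zero_of_mem_span_eigenvectors b' (p := fun i => eig' i ≤ t) (hW hx) hi]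
  rw [← Finset.mul_sum, b'.sum_sq_norm_inner_right, ← b.sum_sq_norm_inner_right x, ← e,
    Finset.mul_sum] at h1
  have hterm (i : ι) : t * ‖⟪b i, x⟫_ℂ‖ ^ 2 ≤ eig i * ‖⟪b i, x⟫_ℂ‖ ^ 2 := by
    by_cases hi : eig i ≤ t
    · simp [h0 i hi]
    · gcongr; exact (not_le.1 hi).le
  have heq := (Finset.sum_eq_sum_iff_of_le fun i _ => hterm i).1
    (le_antisymm (Finset.sum_le_sum fun i _ => hterm i) h1)
  have hall (i : ι) : ‖⟪b i, x⟫_ℂ‖ ^ 2 = 0 := by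
    by_cases hi : eig i ≤ t
    · simp [h0 i hi]
    · have h2 : (eig i - t) * ‖⟪b i, x⟫_ℂ‖ ^ 2 = 0 := by
        linarith [heq i (Finset.mem_univ i)]
      exact (mul_eq_zero.1 h2).resolve_left fun h3 => hi (by linarith)
  have hx0 := b.sum_sq_norm_inner_right x
  simpa [hall] using hx0.symm

end Interlacing

/-- The number of entries of `eig` that are at most `t`. -/
noncomputable def countLE {ι : Type*} [Fintype ι] (eig : ι → ℝ) (t : ℝ) : ℝ :=
  ∑ i, if eig i ≤ t then 1 else 0

theorem countLE_eq_card {ι : Type*} [Fintype ι] (eig : ι → ℝ) (t : ℝ) :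
    countLE eig t = Fintype.card {i // eig i ≤ t} := by
  rw [countLE, Finset.sum_boole, Fintype.card_subtype]

/-- The point `r` stands for one just above `t`: after reflection the entries counted are those with
`eig i ≥ r`, the complement of those with `eig i ≤ t`. -/
theorem countLE_neg {ι : Type*} [Fintype ι] (eig : ι → ℝ) {r t : ℝ}
    (h : ∀ i, eig i < r ↔ eig i ≤ t) :
    countLE (fun i => -eig i) (-r) = Fintype.card ι - countLE eig t := by
  rw [eq_sub_iff_add_eq, countLE, countLE, ← Finset.sum_add_distrib, Fintype.card_eq_sum_ones,
    Nat.cast_sum]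
  refine Finset.sum_congr rfl fun i _ => ?_
  by_cases hi : eig i ≤ t
  · simp [hi, (h i).2 hi]
  · simp [hi, not_lt.1 (fun h' => hi ((h i).1 h'))]

theorem measurable_countLE {ι : Type*} [Fintype ι] (eig : ι → ℝ) : Measurable (countLE eig) :=
  Finset.measurable_fun_sum _ fun _ _ =>
    Measurable.ite measurableSet_Ici measurable_const measurable_const

section Interlacing

variable {E : Type*} [NormedAddCommGroup E] [InnerProductSpace ℂ E]
  {ι ι' : Type*} [Fintype ι] [Fintype ι']
  {A B : E →ₗ[ℂ] E} (hA : A.IsSymmetric) (hB : B.IsSymmetric)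
  (b : OrthonormalBasis ι ℂ E) (b' : OrthonormalBasis ι' ℂ E) {eig : ι → ℝ} {eig' : ι' → ℝ}
  (hb : ∀ i, A (b i) = (eig i : ℂ) • b i) (hb' : ∀ i, B (b' i) = (eig' i : ℂ) • b' i)

include hA hB hb hb'

/-- Intersecting the low spectral subspace of `B` with the orthogonal complement of `d` costs at
most one dimension. -/
theorem countLE_le_countLE_add_one {d : E}
    (hAB : ∀ x, ⟪d, x⟫_ℂ = 0 → ⟪x, A x⟫_ℂ = ⟪x, B x⟫_ℂ) (t : ℝ) :
    countLE eig' t ≤ countLE eig t + 1 := by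
  have : FiniteDimensional ℂ E := b.toBasis.finiteDimensional_of_finite
  have h1 := finrank_le_finrank_inf_orthogonal_add_one
    (Submodule.span ℂ (Set.range fun i : {i // eig' i ≤ t} => b' i)) d
  have h2 := finrank_le_card_le hA hB b b' hb hb' (t := t)
    (W := Submodule.span ℂ (Set.range fun i : {i // eig' i ≤ t} => b' i) ⊓ (ℂ ∙ d)ᗮ)
    inf_le_left fun x hx => hAB x (Submodule.mem_orthogonal_singleton_iff_inner_right.1 hx.2)
  rw [finrank_span_eigenvectors b' fun i => eig' i ≤ t] at h1
  rw [countLE_eq_card, countLE_eq_card]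
  exact_mod_cast h1.trans (Nat.add_le_add_right h2 1)

/-- No dimension is lost here: eigenvectors of `B` with negative eigenvalue are already orthogonal
to the kernel vector `d`. -/
theorem countLE_le_countLE_of_neg {d : E} (hBd : B d = 0)
    (hAB : ∀ x, ⟪d, x⟫_ℂ = 0 → ⟪x, A x⟫_ℂ = ⟪x, B x⟫_ℂ) {t : ℝ} (ht : t < 0) :
    countLE eig' t ≤ countLE eig t := by
  have h2 := finrank_le_card_le hA hB b b' hb hb' (t := t) le_rfl fun x hx => hAB x ?_
  · rw [finrank_span_eigenvectors b' fun i => eig' i ≤ t] at h2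
    rw [countLE_eq_card, countLE_eq_card]
    exact_mod_cast h2
  · have hle : Submodule.span ℂ (Set.range fun i : {i // eig' i ≤ t} => b' i) ≤ (ℂ ∙ d)ᗮ := by
      rw [Submodule.span_le]
      rintro _ ⟨⟨i, hi⟩, rfl⟩
      refine Submodule.mem_orthogonal_singleton_iff_inner_right.2 ?_
      have h3 : ⟪d, B (b' i)⟫_ℂ = 0 := by rw [← hB, hBd, inner_zero_left]
      rw [hb', inner_smul_right] at h3
      refine (mul_eq_zero.1 h3).resolve_left ?_
      exact_mod_cast (hi.trans_lt ht).ne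
    exact Submodule.mem_orthogonal_singleton_iff_inner_right.1 (hle hx)

/-- The negative case applied to `-A` and `-B` at `-r`, with `r > t` so close to `t` that no
eigenvalue of either lies strictly between. -/
theorem countLE_le_countLE_of_nonneg {d : E} (hBd : B d = 0)
    (hAB : ∀ x, ⟪d, x⟫_ℂ = 0 → ⟪x, A x⟫_ℂ = ⟪x, B x⟫_ℂ) {t : ℝ} (ht : 0 ≤ t) :
    countLE eig t ≤ countLE eig' t := by
  have hev (s : ℝ) : ∀ᶠ r in 𝓝[>] t, s < r ↔ s ≤ t := by
    rcases le_or_gt s t with h | h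
    · filter_upwards [self_mem_nhdsWithin] with r hr
      exact ⟨fun _ => h, fun _ => h.trans_lt hr⟩
    · filter_upwards [nhdsWithin_le_nhds (gt_mem_nhds h)] with r hr
      exact ⟨fun h' => absurd h' hr.not_gt, fun h' => absurd h' h.not_ge⟩
  obtain ⟨r, h1, h2, hr⟩ := ((eventually_all.2 fun i => hev (eig i)).and
    ((eventually_all.2 fun i => hev (eig' i)).and self_mem_nhdsWithin)).exists
  have hcard : Fintype.card ι = Fintype.card ι' := by
    rw [← Module.finrank_eq_card_basis b.toBasis, ← Module.finrank_eq_card_basis b'.toBasis]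
  have h := countLE_le_countLE_of_neg (A := -A) (B := -B) (fun x y => by simp [hA x y])
    (fun x y => by simp [hB x y]) b b'
    (eig := fun i => -eig i) (eig' := fun i => -eig' i) (by simp [hb]) (by simp [hb']) (d := d)
    (by simp [hBd]) (fun x hx => by simp [hAB x hx]) (t := -r)
    (neg_lt_zero.2 (ht.trans_lt hr))
  rw [countLE_neg eig h1, countLE_neg eig' h2, hcard] at h
  linarith

/-- The counting functions of a symmetric operator `A` and of its compression to the orthogonal
complement of a vector `d`, the latter extended by `0` at `d`, interlace. -/
theorem countLE_sub_countLE_mem_Icc {d : E} (hBd : B d = 0)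
    (hAB : ∀ x, ⟪d, x⟫_ℂ = 0 → ⟪x, A x⟫_ℂ = ⟪x, B x⟫_ℂ) (t : ℝ) :
    countLE eig t - countLE eig' t + (if 0 ≤ t then 1 else 0) ∈ Set.Icc 0 1 := by
  have h1 := countLE_le_countLE_add_one hA hB b b' hb hb' hAB t
  have h2 := countLE_le_countLE_add_one hB hA b' b hb' hb (fun x hx => (hAB x hx).symm) t
  split_ifs with ht
  · have h3 := countLE_le_countLE_of_nonneg hA hB b b' hb hb' hBd hAB ht
    constructor <;> linarith
  · have h3 := countLE_le_countLE_of_neg hA hB b b' hb hb' hBd hAB (not_le.1 ht)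
    constructor <;> linarith

end Interlacing

theorem integral_deriv_mul_ite {R : ℝ} {f : ℝ → ℝ} (hf : ContDiff ℝ 1 f) {c : ℝ}
    (hc : c ∈ Set.Icc (-R) R) :
    ∫ t in Set.Icc (-R) R, deriv f t * (if c ≤ t then 1 else 0) = f R - f c := by
  have e : (fun t => deriv f t * (if c ≤ t then (1 : ℝ) else 0)) =
      (Set.Ici c).indicator (deriv f) := by
    ext t
    by_cases h : c ≤ t <;> simp [h]
  have hs : Set.Icc (-R) R ∩ Set.Ici c = Set.Icc c R := by
    ext t
    simp only [Set.mem_inter_iff, Set.mem_Icc, Set.mem_Ici]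
    constructor
    · rintro ⟨⟨_, h2⟩, h3⟩; exact ⟨h3, h2⟩
    · rintro ⟨h1, h2⟩; exact ⟨⟨hc.1.trans h1, h2⟩, h1⟩
  rw [e, setIntegral_indicator measurableSet_Ici, hs, integral_Icc_eq_integral_Ioc,
    ← intervalIntegral.integral_of_le hc.2]
  exact intervalIntegral.integral_deriv_eq_sub
    (fun x _ => hf.differentiable one_ne_zero x)
    ((hf.continuous_deriv le_rfl).intervalIntegrable _ _)

theorem integrable_deriv_mul_ite {R : ℝ} {f : ℝ → ℝ} (hf : ContDiff ℝ 1 f) (c : ℝ) :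
    IntegrableOn (fun t => deriv f t * (if c ≤ t then 1 else 0)) (Set.Icc (-R) R) := by
  have e : (fun t => deriv f t * (if c ≤ t then (1 : ℝ) else 0)) =
      (Set.Ici c).indicator (deriv f) := by
    ext t
    by_cases h : c ≤ t <;> simp [h]
  rw [e]
  exact ((hf.continuous_deriv le_rfl).continuousOn.integrableOn_compact isCompact_Icc).indicator
    measurableSet_Ici

theorem integral_deriv_mul_countLE {ι : Type*} [Fintype ι] {R : ℝ} {f : ℝ → ℝ}
    (hf : ContDiff ℝ 1 f) {eig : ι → ℝ} (h : ∀ i, eig i ∈ Set.Icc (-R) R) :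
    IntegrableOn (fun t => deriv f t * countLE eig t) (Set.Icc (-R) R) ∧
      ∫ t in Set.Icc (-R) R, deriv f t * countLE eig t =
        Fintype.card ι * f R - ∑ i, f (eig i) := by
  simp only [countLE, Finset.mul_sum]
  refine ⟨integrable_finsetSum _ fun i _ => integrable_deriv_mul_ite hf (eig i), ?_⟩
  rw [integral_finsetSum _ fun i _ => integrable_deriv_mul_ite hf (eig i),
    Finset.sum_congr rfl fun i _ => integral_deriv_mul_ite hf (h i), Finset.sum_sub_distrib]
  simp

/-- Each eigenvalue `c` contributes `∫_c^R f' = f R - f c`. The terms `f R` cancel because the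
numbers of eigenvalues agree, and the indicator of `t ≥ 0` accounts for `f R - f 0`. -/
theorem sum_sub_sum_eq_sub_integral {ι ι' : Type*} [Fintype ι] [Fintype ι']
    (hcard : Fintype.card ι = Fintype.card ι') {R : ℝ} (hR : 0 ≤ R) {f : ℝ → ℝ}
    (hf : ContDiff ℝ 1 f) {eig : ι → ℝ} {eig' : ι' → ℝ} (h : ∀ i, eig i ∈ Set.Icc (-R) R)
    (h' : ∀ i, eig' i ∈ Set.Icc (-R) R) :
    ∑ i, f (eig i) - ∑ i, f (eig' i) = f R - f 0 - ∫ t in Set.Icc (-R) R,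
      deriv f t * (countLE eig t - countLE eig' t + (if 0 ≤ t then 1 else 0)) := by
  obtain ⟨i1, e1⟩ := integral_deriv_mul_countLE hf h
  obtain ⟨i2, e2⟩ := integral_deriv_mul_countLE hf h'
  have e3 := integral_deriv_mul_ite hf (c := 0) (R := R) ⟨by linarith, hR⟩
  have i3 := integrable_deriv_mul_ite (R := R) hf 0
  simp only [mul_add, mul_sub]
  have i12 : IntegrableOn (fun t => deriv f t * countLE eig t - deriv f t * countLE eig' t)
      (Set.Icc (-R) R) := i1.sub i2
  rw [integral_add i12 i3, integral_sub i1 i2, e1, e2, e3, hcard]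
  ring

end JacobiTrace

/-! ### Weak compactness of functions with values in the unit interval -/

namespace JacobiTrace

/-- A family of functions with values in `[0, 1]` has a weak limit along an ultrafilter. -/
theorem exists_weak_limit {ι : Type*} {l : Filter ι} [l.NeBot] (μ : Measure ℝ) [IsFiniteMeasure μ]
    {x : ι → ℝ → ℝ} (hm : ∀ i, Measurable (x i)) (h01 : ∀ᶠ i in l, ∀ t, x i t ∈ Set.Icc (0 : ℝ) 1) :
    ∃ ξ : ℝ → ℝ, Measurable ξ ∧ (∀ᵐ t ∂μ, 0 ≤ ξ t ∧ ξ t ≤ 1) ∧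
      ∀ (g : ℝ → ℝ) (c : ℝ), MemLp g 2 μ → Tendsto (fun i => ∫ t, g t * x i t ∂μ) l (𝓝 c) →
        ∫ t, g t * ξ t ∂μ = c := by
  classical
  obtain ⟨X, hX⟩ : ∃ X : ι → Lp ℝ 2 μ, ∀ i, (∀ t, x i t ∈ Set.Icc (0 : ℝ) 1) → X i =ᵐ[μ] x i := by
    have (i : ι) : ∃ y : Lp ℝ 2 μ, (∀ t, x i t ∈ Set.Icc (0 : ℝ) 1) → y =ᵐ[μ] x i := by
      by_cases h : ∀ t, x i t ∈ Set.Icc (0 : ℝ) 1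
      · have hL : MemLp (x i) 2 μ := MemLp.of_bound (hm i).aestronglyMeasurable 1
          (.of_forall fun t => by rw [Real.norm_eq_abs, abs_of_nonneg (h t).1]; exact (h t).2)
        exact ⟨hL.toLp, fun _ => hL.coeFn_toLp⟩
      · exact ⟨0, fun h' => absurd h' h⟩
    exact ⟨fun i => (this i).choose, fun i => (this i).choose_spec⟩
  -- An ultrafilter replaces the choice of a subsequence, since the index will be the directed set
  -- of finite sets of basis vectors.
  set U : Ultrafilter ι := Ultrafilter.of l
  have hU : (U : Filter ι) ≤ l := Ultrafilter.of_le l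
  set D : ι → WeakDual ℝ (Lp ℝ 2 μ) := fun i =>
    StrongDual.toWeakDual (InnerProductSpace.toDual ℝ (Lp ℝ 2 μ) (X i))
  set M : ℝ := ‖MemLp.toLp (fun _ : ℝ => (1 : ℝ)) (memLp_const (μ := μ) (p := 2) (1 : ℝ))‖
  have hball : ∀ᶠ i in (U : Filter ι), D i ∈ WeakDual.toStrongDual ⁻¹' Metric.closedBall
      (0 : StrongDual ℝ (Lp ℝ 2 μ)) M := by
    filter_upwards [hU h01] with i hi
    rw [Set.mem_preimage, mem_closedBall_zero_iff]
    change ‖InnerProductSpace.toDual ℝ (Lp ℝ 2 μ) (X i)‖ ≤ M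
    rw [LinearIsometryEquiv.norm_map]
    refine Lp.norm_le_norm_of_ae_le ?_
    filter_upwards [hX i hi, (memLp_const (μ := μ) (p := 2) (1 : ℝ)).coeFn_toLp] with t h1 h2
    rw [h1, h2, norm_one, Real.norm_eq_abs, abs_of_nonneg (hi t).1]
    exact (hi t).2
  -- Banach–Alaoglu in the dual of `L²`; the limit functional is then represented by a function `Ξ`.
  obtain ⟨Λ, -, hΛ⟩ :=
    (WeakDual.isCompact_closedBall (0 : StrongDual ℝ (Lp ℝ 2 μ)) M).ultrafilter_le_nhds
    (U.map D) (le_principal_iff.2 hball)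
  obtain ⟨Ξ, hΞ⟩ := (InnerProductSpace.toDual ℝ (Lp ℝ 2 μ)).surjective (WeakDual.toStrongDual Λ)
  have key (g : ℝ → ℝ) (hg : MemLp g 2 μ) :
      Tendsto (fun i => ∫ t, g t * x i t ∂μ) U (𝓝 (∫ t, g t * Ξ t ∂μ)) := by
    have h1 : Tendsto (fun i => D i hg.toLp) U (𝓝 (Λ hg.toLp)) :=
      (WeakDual.eval_continuous hg.toLp).continuousAt.tendsto.comp hΛ
    have h2 (Y : Lp ℝ 2 μ) : ⟪Y, hg.toLp⟫_ℝ = ∫ t, g t * Y t ∂μ := by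
      rw [L2.inner_def]
      refine integral_congr_ae ?_
      filter_upwards [hg.coeFn_toLp] with t ht
      simp [ht]
    have h3 : Λ hg.toLp = ∫ t, g t * Ξ t ∂μ := by
      rw [← h2]
      exact (DFunLike.congr_fun hΞ hg.toLp).symm
    rw [h3] at h1
    refine h1.congr' ?_
    filter_upwards [hU h01] with i hi
    change ⟪X i, hg.toLp⟫_ℝ = _
    rw [h2]
    refine integral_congr_ae ?_
    filter_upwards [hX i hi] with t ht
    rw [ht]
  -- Testing against indicators carries the bounds `0` and `1` over to the weak limit.
  have hset (s : Set ℝ) (hs : MeasurableSet s) :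
      ∫ t in s, Ξ t ∂μ ∈ Set.Icc 0 (∫ t in s, (1 : ℝ) ∂μ) := by
    have h1 := key (s.indicator 1) ((memLp_const (1 : ℝ)).indicator hs)
    have hmul (y : ℝ → ℝ) : ∫ t, s.indicator 1 t * y t ∂μ = ∫ t in s, y t ∂μ := by
      rw [← integral_indicator hs]
      refine integral_congr_ae (.of_forall fun t => ?_)
      by_cases ht : t ∈ s <;> simp [ht]
    simp only [hmul] at h1
    refine isClosed_Icc.mem_of_tendsto h1 ?_
    filter_upwards [hU h01] with i hi
    refine ⟨integral_nonneg fun t => (hi t).1, ?_⟩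
    refine integral_mono_of_nonneg (.of_forall fun t => (hi t).1) (integrable_const _)
      (.of_forall fun t => (hi t).2)
  have hint : Integrable Ξ μ := (Lp.memLp Ξ).integrable one_le_two
  have h0 : 0 ≤ᵐ[μ] Ξ :=
    ae_nonneg_of_forall_setIntegral_nonneg hint fun s hs _ => (hset s hs).1
  have h1 : Ξ ≤ᵐ[μ] fun _ => (1 : ℝ) :=
    ae_le_of_forall_setIntegral_le hint (integrable_const _) fun s hs _ => (hset s hs).2
  have hmeas := Lp.aestronglyMeasurable Ξ
  refine ⟨hmeas.mk Ξ, hmeas.stronglyMeasurable_mk.measurable, ?_, fun g c hg hc => ?_⟩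
  · filter_upwards [h0, h1, hmeas.ae_eq_mk] with t ht0 ht1 ht
    rw [← ht]
    exact ⟨ht0, ht1⟩
  · rw [← tendsto_nhds_unique (key g hg) (hc.mono_left hU)]
    refine integral_congr_ae ?_
    filter_upwards [hmeas.ae_eq_mk] with t ht
    rw [← ht]

end JacobiTrace

/-! ### Functional calculus of an operator and of its decoupling -/

namespace JacobiTrace

variable {H : Type*} [NormedAddCommGroup H] [InnerProductSpace ℂ H] [CompleteSpace H]

theorem spectrum_subset_realSeg {A : H →L[ℂ] H} (hA : IsSelfAdjoint A) {R : ℝ} (hR : ‖A‖ ≤ R) :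
    spectrum ℂ A ⊆ realSeg R := by
  intro z hz
  have h1 : ‖z‖ ≤ R := by
    refine (spectrum.norm_le_norm_mul_of_mem hz).trans (le_trans ?_ hR)
    exact mul_le_of_le_one_right (norm_nonneg _) ContinuousLinearMap.norm_id_le
  have h2 := hA.mem_spectrum_eq_re hz
  exact ⟨z.re, abs_le.1 ((Complex.abs_re_le_norm z).trans h1), h2.symm⟩

/-- The functional calculus of a self-adjoint operator of norm at most `R`, for continuous
functions on `[-R, R]`. -/
noncomputable def calcHom (A : H →L[ℂ] H) (hA : IsSelfAdjoint A) {R : ℝ} (hR : ‖A‖ ≤ R) :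
    C(realSeg R, ℂ) →⋆ₐ[ℂ] (H →L[ℂ] H) :=
  cfcHomSuperset hA.isStarNormal (spectrum_subset_realSeg hA hR)

theorem calcHom_idMap (A : H →L[ℂ] H) (hA : IsSelfAdjoint A) {R : ℝ} (hR : ‖A‖ ≤ R) :
    calcHom A hA hR (idMap (realSeg R)) = A :=
  cfcHomSuperset_id _ _

theorem calcHom_realMap (A : H →L[ℂ] H) (hA : IsSelfAdjoint A) {R : ℝ} (hR : ‖A‖ ≤ R)
    (f : C(ℝ, ℝ)) : calcHom A hA hR (realMap R f) = funcCalc f A := by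
  rw [funcCalc, cfc_real_eq_complex _ hA, calcHom, cfcHomSuperset_apply,
    cfc_apply _ _ hA.isStarNormal]
  rfl

theorem star_idMap_realSeg (R : ℝ) : star (idMap (realSeg R)) = idMap (realSeg R) := by
  ext z
  rw [ContinuousMap.star_apply, idMap_apply, ← (mem_realSeg z).2]
  exact Complex.conj_ofReal _

section Compression

variable (K : Submodule ℂ H) [K.HasOrthogonalProjection]

/-- The compression of an operator to the orthogonal complement of `K`. -/
noncomputable def compression (A : H →L[ℂ] H) : Kᗮ →L[ℂ] Kᗮ :=
  Kᗮ.orthogonalProjectionOnto ∘L A ∘L Kᗮ.subtypeL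

theorem isSelfAdjoint_compression {A : H →L[ℂ] H} (hA : IsSelfAdjoint A) :
    IsSelfAdjoint (compression K A) := by
  rw [ContinuousLinearMap.isSelfAdjoint_iff_isSymmetric] at hA ⊢
  intro u w
  simpa [compression] using hA u w

omit [CompleteSpace H] in
theorem norm_compression_le (A : H →L[ℂ] H) : ‖compression K A‖ ≤ ‖A‖ := by
  refine ContinuousLinearMap.opNorm_le_bound _ (norm_nonneg A) fun u => ?_
  have h1 : ‖compression K A u‖ ≤ ‖A (u : H)‖ :=
    Submodule.norm_orthogonalProjectionOnto_apply_le Kᗮ (A (u : H))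
  have h2 : ‖A (u : H)‖ ≤ ‖A‖ * ‖(u : H)‖ := A.le_opNorm (u : H)
  exact h1.trans h2

/-- The extension of a representation on the orthogonal complement of `K` to the whole space, by
the evaluation at `z` on `K`. -/
noncomputable def extendHom {S : Set ℂ} [CompactSpace S] (Ψ : C(S, ℂ) →⋆ₐ[ℂ] (Kᗮ →L[ℂ] Kᗮ))
    (z : S) : C(S, ℂ) →⋆ₐ[ℂ] (H →L[ℂ] H) where
  toFun g := Kᗮ.subtypeL ∘L Ψ g ∘L Kᗮ.orthogonalProjectionOnto + g z • K.starProjection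
  map_one' := by
    ext u
    simp [Submodule.starProjection_orthogonal_val]
  map_mul' f g := by
    ext u
    have h (x : Kᗮ) : K.starProjection (x : H) = 0 :=
      (Submodule.starProjection_apply_eq_zero_iff _).2 x.2
    have h' (x : H) : Kᗮ.orthogonalProjectionOnto (K.starProjection x) = 0 :=
      Submodule.orthogonalProjectionOnto_orthogonal_apply_eq_zero
        (K.starProjection_apply_mem x)
    have h'' (x : H) : K.starProjection (K.starProjection x) = K.starProjection x :=
      Submodule.starProjection_eq_self_iff.2 (K.starProjection_apply_mem x)
    simp [h, h', h'', mul_smul]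
  map_zero' := by simp
  map_add' f g := by
    ext u
    simp [add_smul]
    abel
  commutes' r := by
    ext u
    have h := K.starProjection_add_starProjection_orthogonal u
    have e : Ψ (algebraMap ℂ _ r) = algebraMap ℂ _ r := AlgHomClass.commutes Ψ r
    simp only [e]
    change r • (Kᗮ.starProjection u) + r • K.starProjection u = r • u
    rw [← smul_add, add_comm, h]
  map_star' g := by
    rw [ContinuousLinearMap.star_eq_adjoint, map_add, map_star,
      ContinuousLinearMap.adjoint_comp, ContinuousLinearMap.adjoint_comp,
      Submodule.adjoint_subtypeL, Submodule.adjoint_orthogonalProjectionOnto,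
      ContinuousMap.star_apply, map_smulₛₗ, ← ContinuousLinearMap.star_eq_adjoint,
      ← ContinuousLinearMap.star_eq_adjoint (A := K.starProjection),
      (isSelfAdjoint_starProjection K).star_eq]
    rfl

theorem extendHom_apply {S : Set ℂ} [CompactSpace S] (Ψ : C(S, ℂ) →⋆ₐ[ℂ] (Kᗮ →L[ℂ] Kᗮ))
    (z : S) (g : C(S, ℂ)) : extendHom K Ψ z g =
      Kᗮ.subtypeL ∘L Ψ g ∘L Kᗮ.orthogonalProjectionOnto + g z • K.starProjection := rfl

end Compression

section RankTwo

variable {d : H} (hd : ‖d‖ = 1)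

theorem zero_mem_realSeg {R : ℝ} (hR : 0 ≤ R) : (0 : ℂ) ∈ realSeg R :=
  ⟨0, ⟨neg_nonpos.2 hR, hR⟩, rfl⟩

/-- The functional calculus of the compression of `A` to `dᗮ`, with the value at `0` on `d`. -/
noncomputable def decoupledHom (d : H) (A : H →L[ℂ] H) (hA : IsSelfAdjoint A) {R : ℝ}
    (hR : ‖A‖ ≤ R) : C(realSeg R, ℂ) →⋆ₐ[ℂ] (H →L[ℂ] H) :=
  extendHom (ℂ ∙ d) (calcHom (compression (ℂ ∙ d) A) (isSelfAdjoint_compression _ hA)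
    ((norm_compression_le _ A).trans hR)) ⟨0, zero_mem_realSeg ((norm_nonneg A).trans hR)⟩

theorem decoupledHom_idMap (d : H) (A : H →L[ℂ] H) (hA : IsSelfAdjoint A) {R : ℝ}
    (hR : ‖A‖ ≤ R) : decoupledHom d A hA hR (idMap (realSeg R)) =
      (ℂ ∙ d)ᗮ.starProjection ∘L A ∘L (ℂ ∙ d)ᗮ.starProjection := by
  rw [decoupledHom, extendHom_apply, calcHom_idMap, idMap_apply, zero_smul, add_zero]
  rfl

include hd

omit [CompleteSpace H] in
theorem starProjection_orthogonal_singleton_apply (u : H) :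
    (ℂ ∙ d)ᗮ.starProjection u = u - ⟪d, u⟫_ℂ • d := by
  rw [Submodule.starProjection_orthogonal_val, Submodule.starProjection_unit_singleton ℂ hd]

/-- With `P = 1 - |d⟩⟨d|`, this is the expansion of `A - P A P`. -/
theorem calcHom_sub_decoupledHom (A : H →L[ℂ] H) (hA : IsSelfAdjoint A) {R : ℝ}
    (hR : ‖A‖ ≤ R) :
    calcHom A hA hR (idMap (realSeg R)) - decoupledHom d A hA hR (idMap (realSeg R)) =
      InnerProductSpace.rankOne ℂ d (A d - ⟪A d, d⟫_ℂ • d) +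
      InnerProductSpace.rankOne ℂ (A d) d := by
  rw [calcHom_idMap, decoupledHom_idMap]
  ext u
  have hs : ⟪d, A u⟫_ℂ = ⟪A d, u⟫_ℂ :=
    ((ContinuousLinearMap.isSelfAdjoint_iff_isSymmetric.1 hA) d u).symm
  simp only [sub_apply, add_apply, ContinuousLinearMap.comp_apply,
    starProjection_orthogonal_singleton_apply hd, InnerProductSpace.rankOne_apply, map_sub,
    map_smul, inner_sub_right, inner_smul_left, inner_smul_right, hs,
    inner_conj_symm]
  module

end RankTwo

end JacobiTrace

/-! ### Finite-dimensional shift functions and truncations -/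

namespace JacobiTrace

variable {H : Type*} [NormedAddCommGroup H] [InnerProductSpace ℂ H] [CompleteSpace H]

section FiniteDimensional

omit [CompleteSpace H] in
theorem sum_inner_eq_sum_inner {E : Submodule ℂ H} {ι ι' : Type*} [Fintype ι] [Fintype ι']
    (e : OrthonormalBasis ι ℂ E) (e' : OrthonormalBasis ι' ℂ E) (T : H →L[ℂ] H) :
    ∑ i, ⟪(e i : H), T (e i)⟫_ℂ = ∑ i, ⟪(e' i : H), T (e' i)⟫_ℂ := by
  have : FiniteDimensional ℂ E := e.toBasis.finiteDimensional_of_finite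
  set C : E →ₗ[ℂ] E := ((E.orthogonalProjectionOnto ∘L T ∘L E.subtypeL : E →L[ℂ] E) : E →ₗ[ℂ] E)
  have h (x : E) : ⟪x, C x⟫_ℂ = ⟪(x : H), T x⟫_ℂ := by simp [C]
  simp only [← h]
  rw [← LinearMap.trace_eq_sum_inner C e, ← LinearMap.trace_eq_sum_inner C e']

theorem inner_starAlgHom_idMap {R : ℝ} (Θ : C(realSeg R, ℂ) →⋆ₐ[ℂ] (H →L[ℂ] H)) (x y : H) :
    ⟪Θ (idMap (realSeg R)) x, y⟫_ℂ = ⟪x, Θ (idMap (realSeg R)) y⟫_ℂ := by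
  have h : IsSelfAdjoint (Θ (idMap (realSeg R))) := by
    rw [IsSelfAdjoint, ← map_star, star_idMap_realSeg]
  exact (ContinuousLinearMap.isSelfAdjoint_iff_isSymmetric.1 h) x y

theorem norm_starAlgHom_idMap_le {R : ℝ} (hR : 0 ≤ R) (Θ : C(realSeg R, ℂ) →⋆ₐ[ℂ] (H →L[ℂ] H)) :
    ‖Θ (idMap (realSeg R))‖ ≤ R := by
  refine (NonUnitalStarAlgHom.norm_apply_le Θ _).trans ?_
  refine (ContinuousMap.norm_le _ hR).2 fun z => ?_
  rw [idMap_apply, ← (mem_realSeg z).2, Complex.norm_real, Real.norm_eq_abs]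
  exact abs_le.2 (mem_realSeg z).1

theorem exists_eigenbasis {R : ℝ} (hR : 0 ≤ R) (Θ : C(realSeg R, ℂ) →⋆ₐ[ℂ] (H →L[ℂ] H))
    {E : Submodule ℂ H} [FiniteDimensional ℂ E] (hE : ∀ x ∈ E, Θ (idMap (realSeg R)) x ∈ E) :
    ∃ (T : E →ₗ[ℂ] E) (e : OrthonormalBasis (Fin (Module.finrank ℂ E)) ℂ E)
      (eig : Fin (Module.finrank ℂ E) → ℝ), T.IsSymmetric ∧
      (∀ x : E, (T x : H) = Θ (idMap (realSeg R)) x) ∧ (∀ i, T (e i) = (eig i : ℂ) • e i) ∧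
      (∀ i, eig i ∈ Set.Icc (-R) R) ∧
      ∀ (f : C(ℝ, ℝ)) i, Θ (realMap R f) (e i) = (f (eig i) : ℂ) • (e i : H) := by
  set T : E →ₗ[ℂ] E := (Θ (idMap (realSeg R)) : H →ₗ[ℂ] H).restrict hE
  have hTs (x : E) : (T x : H) = Θ (idMap (realSeg R)) x := rfl
  have hT : T.IsSymmetric := fun x y => inner_starAlgHom_idMap Θ x y
  have he (i) : T (hT.eigenvectorBasis rfl i) =
      (hT.eigenvalues rfl i : ℂ) • hT.eigenvectorBasis rfl i := hT.apply_eigenvectorBasis rfl i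
  have he' (i) : Θ (idMap (realSeg R)) (hT.eigenvectorBasis rfl i) =
      (hT.eigenvalues rfl i : ℂ) • (hT.eigenvectorBasis rfl i : H) := by
    rw [← hTs, he]; rfl
  have hmem (i) : hT.eigenvalues rfl i ∈ Set.Icc (-R) R := by
    refine abs_le.1 ?_
    have h1 := ((Θ (idMap (realSeg R))).le_opNorm (hT.eigenvectorBasis rfl i : H)).trans
      (mul_le_mul_of_nonneg_right (norm_starAlgHom_idMap_le hR Θ) (norm_nonneg _))
    have h2 : ‖(hT.eigenvectorBasis rfl i : H)‖ = 1 := (hT.eigenvectorBasis rfl).norm_eq_one i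
    rw [he', norm_smul, h2, mul_one, mul_one] at h1
    simpa using h1
  refine ⟨T, hT.eigenvectorBasis rfl, hT.eigenvalues rfl, hT, hTs, he, hmem, fun f i => ?_⟩
  have h := starAlgHom_apply_eigenvector Θ (star_idMap_realSeg R)
    (z := ⟨(hT.eigenvalues rfl i : ℂ), _, hmem i, rfl⟩) (he' i) (realMap R f)
  simpa using h

/-- On basis vectors outside `F` both operators vanish, so both calculi act as `f 0` there and
cancel. The trace thus lives on `E`, where interlacing applies with kernel vector `b n`. -/
theorem exists_finite_spectral_shift {κ : Type*} (b : HilbertBasis κ ℂ H) {F : Finset κ} {n : κ}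
    (hn : n ∈ F) {R : ℝ} (hR : 0 ≤ R) {Θ Θ' : C(realSeg R, ℂ) →⋆ₐ[ℂ] (H →L[ℂ] H)}
    {E : Submodule ℂ H} (eE : OrthonormalBasis F ℂ E) (heE : ∀ m, (eE m : H) = b m)
    (hE : ∀ x ∈ E, Θ (idMap (realSeg R)) x ∈ E) (hE' : ∀ x ∈ E, Θ' (idMap (realSeg R)) x ∈ E)
    (h0 : ∀ m ∉ F, Θ (idMap (realSeg R)) (b m) = 0)
    (h0' : ∀ m ∉ F, Θ' (idMap (realSeg R)) (b m) = 0) (hd : Θ' (idMap (realSeg R)) (b n) = 0)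
    (hin : ∀ x, ⟪b n, x⟫_ℂ = 0 →
      ⟪x, Θ (idMap (realSeg R)) x⟫_ℂ = ⟪x, Θ' (idMap (realSeg R)) x⟫_ℂ) :
    ∃ ξ : ℝ → ℝ, Measurable ξ ∧ (∀ t, ξ t ∈ Set.Icc (0 : ℝ) 1) ∧
      ∀ f : C(ℝ, ℝ), ContDiff ℝ 1 f → ∀ τ : ℂ,
        HasSum (fun m => ⟪b m, (Θ (realMap R f) - Θ' (realMap R f)) (b m)⟫_ℂ) τ →
        τ = ((f R - f 0 - ∫ t in Set.Icc (-R) R, deriv f t * ξ t : ℝ) : ℂ) := by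
  have : FiniteDimensional ℂ E := eE.toBasis.finiteDimensional_of_finite
  obtain ⟨T, e, eig, hT, hTΘ, he, hmem, hf⟩ := exists_eigenbasis hR Θ hE
  obtain ⟨T', e', eig', hT', hTΘ', he', hmem', hf'⟩ := exists_eigenbasis hR Θ' hE'
  set d : E := eE ⟨n, hn⟩
  have hd' : T' d = 0 := Subtype.ext (by rw [hTΘ', heE]; exact hd)
  have hin' (x : E) (hx : ⟪d, x⟫_ℂ = 0) : ⟪x, T x⟫_ℂ = ⟪x, T' x⟫_ℂ := by
    have := hin x (by rw [← heE ⟨n, hn⟩]; exact hx)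
    rwa [← hTΘ, ← hTΘ'] at this
  refine ⟨fun t => countLE eig t - countLE eig' t + (if 0 ≤ t then 1 else 0),
    ((measurable_countLE eig).sub (measurable_countLE eig')).add
      (Measurable.ite measurableSet_Ici measurable_const measurable_const),
    countLE_sub_countLE_mem_Icc hT hT' e e' he he' hd' hin', fun f hfc τ hτ => ?_⟩
  have hzero {Ξ : C(realSeg R, ℂ) →⋆ₐ[ℂ] (H →L[ℂ] H)} {u : H}
      (hu : Ξ (idMap (realSeg R)) u = 0) : Ξ (realMap R f) u = (f 0 : ℂ) • u := by
    have h := starAlgHom_apply_eigenvector Ξ (star_idMap_realSeg R)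
      (z := ⟨0, zero_mem_realSeg hR⟩) (by simpa using hu) (realMap R f)
    simpa using h
  have hsum {Ξ : C(realSeg R, ℂ) →⋆ₐ[ℂ] (H →L[ℂ] H)}
      {c : OrthonormalBasis (Fin (Module.finrank ℂ E)) ℂ E} {g : Fin (Module.finrank ℂ E) → ℝ}
      (hg : ∀ i, Ξ (realMap R f) (c i) = (f (g i) : ℂ) • (c i : H)) :
      ∑ m ∈ F, ⟪b m, Ξ (realMap R f) (b m)⟫_ℂ = ((∑ i, f (g i) : ℝ) : ℂ) := by
    rw [← Finset.sum_coe_sort F]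
    simp only [← heE]
    rw [sum_inner_eq_sum_inner eE c, Complex.ofReal_sum]
    refine Finset.sum_congr rfl fun i _ => ?_
    have h1 : ⟪(c i : H), (c i : H)⟫_ℂ = 1 := by
      have h2 : ‖(c i : H)‖ = 1 := c.norm_eq_one i
      rw [inner_self_eq_norm_sq_to_K, h2]
      simp
    rw [hg, inner_smul_right, h1, mul_one]
  have hfin : τ = ∑ m ∈ F, ⟪b m, (Θ (realMap R f) - Θ' (realMap R f)) (b m)⟫_ℂ := by
    refine hτ.unique (hasSum_sum_of_ne_finset_zero fun m hm => ?_)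
    rw [sub_apply, hzero (h0 m hm), hzero (h0' m hm), sub_self, inner_zero_right]
  simp only [sub_apply, inner_sub_right, Finset.sum_sub_distrib] at hfin
  rw [hfin, hsum (hf f), hsum (hf' f), ← Complex.ofReal_sub,
    sum_sub_sum_eq_sub_integral rfl hR hfc hmem hmem']

end FiniteDimensional

section Truncation

variable {κ : Type*} (b : HilbertBasis κ ℂ H)

/-- The span of finitely many basis vectors. -/
def coordSpan (F : Finset κ) : Submodule ℂ H := Submodule.span ℂ (b '' F)

instance (F : Finset κ) : FiniteDimensional ℂ (coordSpan b F) :=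
  FiniteDimensional.span_of_finite ℂ (F.finite_toSet.image b)

omit [CompleteSpace H] in
theorem exists_orthonormalBasis_coordSpan (F : Finset κ) :
    ∃ e : OrthonormalBasis F ℂ (coordSpan b F), ∀ m, (e m : H) = b m := by
  classical
  have h : coordSpan b F = Submodule.span ℂ (F.image b : Set H) := by
    rw [coordSpan, Finset.coe_image]
  rw [h]
  exact ⟨OrthonormalBasis.span b.orthonormal F, OrthonormalBasis.span_apply b.orthonormal F⟩

/-- The truncation of an operator to the span of finitely many basis vectors. -/
noncomputable def truncation (F : Finset κ) (A : H →L[ℂ] H) : H →L[ℂ] H :=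
  (coordSpan b F).starProjection ∘L A ∘L (coordSpan b F).starProjection

theorem isSelfAdjoint_truncation (F : Finset κ) {A : H →L[ℂ] H} (hA : IsSelfAdjoint A) :
    IsSelfAdjoint (truncation b F A) :=
  hA.conj_starProjection (coordSpan b F)

omit [CompleteSpace H] in
theorem norm_truncation_le (F : Finset κ) (A : H →L[ℂ] H) : ‖truncation b F A‖ ≤ ‖A‖ := by
  refine ContinuousLinearMap.opNorm_le_bound _ (norm_nonneg A) fun u => ?_
  calc ‖truncation b F A u‖ ≤ ‖A ((coordSpan b F).starProjection u)‖ :=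
        Submodule.norm_starProjection_apply_le _ _
    _ ≤ ‖A‖ * ‖(coordSpan b F).starProjection u‖ := A.le_opNorm _
    _ ≤ ‖A‖ * ‖u‖ := by gcongr; exact Submodule.norm_starProjection_apply_le _ _

omit [CompleteSpace H] in
theorem tendsto_truncation (A : H →L[ℂ] H) (u : H) :
    Tendsto (fun F => truncation b F A u) atTop (𝓝 (A u)) := by
  have hmono : Monotone (coordSpan b) := fun F G h =>
    Submodule.span_mono (Set.image_mono (Finset.coe_subset.2 h))
  have hdense : ⊤ ≤ (⨆ F, coordSpan b F).topologicalClosure := by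
    rw [← b.dense_span]
    refine Submodule.topologicalClosure_mono (Submodule.span_le.2 ?_)
    rintro _ ⟨m, rfl⟩
    exact Submodule.mem_iSup_of_mem {m} (Submodule.subset_span ⟨m, by simp, rfl⟩)
  have hP (x : H) := Submodule.starProjection_tendsto_self (coordSpan b) hmono x hdense
  have h0 : Tendsto (fun F => (coordSpan b F).starProjection
      (A ((coordSpan b F).starProjection u) - A u)) atTop (𝓝 0) := by
    refine squeeze_zero_norm (fun F => Submodule.norm_starProjection_apply_le _ _) ?_
    exact tendsto_iff_norm_sub_tendsto_zero.1 ((A.continuous.tendsto u).comp (hP u))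
  simpa [truncation] using h0.add (hP (A u))

end Truncation

end JacobiTrace

/-! ### The spectral shift function as a weak limit over truncations -/

namespace JacobiTrace

variable {H : Type*} [NormedAddCommGroup H] [InnerProductSpace ℂ H] [CompleteSpace H]

theorem hasNuclearTrace_sub {S : Set ℂ} [CompactSpace S] {f : C(S, ℂ)} {a c : ℕ → C(S, ℂ)}
    (hac : Summable fun i => ‖a i‖ * ‖c i‖) {Φ Ψ : C(S, ℂ) →⋆ₐ[ℂ] (H →L[ℂ] H)}
    (h : HasSum (fun i => Φ (a i) * (Φ (idMap S) - Ψ (idMap S)) * Ψ (c i)) (Φ f - Ψ f))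
    {x₁ x₂ y₁ y₂ : H} (hr : Φ (idMap S) - Ψ (idMap S) =
      InnerProductSpace.rankOne ℂ y₁ x₁ + InnerProductSpace.rankOne ℂ y₂ x₂) :
    HasNuclearTrace (Φ f - Ψ f) ((∑' k, ⟪Ψ (star (c k)) x₁, Φ (a k) y₁⟫_ℂ) +
      ∑' k, ⟪Ψ (star (c k)) x₂, Φ (a k) y₂⟫_ℂ) := by
  have hs (x y : H) : Summable fun i => Φ (a i) * InnerProductSpace.rankOne ℂ y x * Ψ (c i) :=
    .of_norm_bounded (hac.mul_right _) fun i => norm_term_le Φ Ψ _ _ _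
  have h2 := (hs x₁ y₁).hasSum.add (hs x₂ y₂).hasSum
  simp only [hr, mul_add, add_mul] at h
  rw [h.unique h2]
  exact (hasNuclearTrace_tsum Φ Ψ hac x₁ y₁).add (hasNuclearTrace_tsum Φ Ψ hac x₂ y₂)

/-- The span of the basis vectors in `F` is invariant under the truncation and, since it contains `b
n`, also under the decoupled truncation. -/
theorem exists_truncated_spectral_shift {κ : Type*} (b : HilbertBasis κ ℂ H) {n : κ}
    {A : H →L[ℂ] H} (hA : IsSelfAdjoint A) {R : ℝ} (hAR : ‖A‖ ≤ R) {F : Finset κ} (hn : n ∈ F) :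
    ∃ ξ : ℝ → ℝ, Measurable ξ ∧ (∀ t, ξ t ∈ Set.Icc (0 : ℝ) 1) ∧
      ∀ f : C(ℝ, ℝ), ContDiff ℝ 1 f → ∀ τ : ℂ,
        HasSum (fun m => ⟪b m, (calcHom (truncation b F A) (isSelfAdjoint_truncation b F hA)
          ((norm_truncation_le b F A).trans hAR) (realMap R f) -
          decoupledHom (b n) (truncation b F A) (isSelfAdjoint_truncation b F hA)
          ((norm_truncation_le b F A).trans hAR) (realMap R f)) (b m)⟫_ℂ) τ →
        τ = ((f R - f 0 - ∫ t in Set.Icc (-R) R, deriv f t * ξ t : ℝ) : ℂ) := by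
  obtain ⟨e, he⟩ := exists_orthonormalBasis_coordSpan b F
  have hR : 0 ≤ R := (norm_nonneg A).trans hAR
  have hd : ‖b n‖ = 1 := b.orthonormal.1 n
  have hdE : b n ∈ coordSpan b F := Submodule.subset_span ⟨n, hn, rfl⟩
  have hmem (u : H) : truncation b F A u ∈ coordSpan b F := Submodule.starProjection_apply_mem _ _
  have hP := starProjection_orthogonal_singleton_apply hd
  have hout (m : κ) (hm : m ∉ F) : truncation b F A (b m) = 0 := by
    have : (coordSpan b F).starProjection (b m) = 0 := by
      rw [Submodule.starProjection_apply_eq_zero_iff, coordSpan, Submodule.mem_orthogonal]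
      intro u hu
      have hle : Submodule.span ℂ (b '' F) ≤ (ℂ ∙ b m)ᗮ := by
        rw [Submodule.span_le]
        rintro _ ⟨k, hk, rfl⟩
        refine Submodule.mem_orthogonal_singleton_iff_inner_right.2 (b.orthonormal.2 ?_)
        rintro rfl
        exact hm hk
      rw [← inner_conj_symm, Submodule.mem_orthogonal_singleton_iff_inner_right.1 (hle hu),
          map_zero]
    simp [truncation, this]
  refine exists_finite_spectral_shift b hn hR e he ?_ ?_ ?_ ?_ ?_ ?_
  · intro x _
    rw [calcHom_idMap]
    exact hmem x
  · intro x _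
    rw [decoupledHom_idMap, ContinuousLinearMap.comp_apply, hP]
    exact Submodule.sub_mem _ (hmem _) (Submodule.smul_mem _ _ hdE)
  · intro m hm
    rw [calcHom_idMap, hout m hm]
  · intro m hm
    have : ⟪b n, b m⟫_ℂ = 0 := b.orthonormal.2 (by rintro rfl; exact hm hn)
    rw [decoupledHom_idMap, ContinuousLinearMap.comp_apply, ContinuousLinearMap.comp_apply,
      hP (b m), this, zero_smul, sub_zero, hout m hm, map_zero]
  · have : ⟪b n, b n⟫_ℂ = 1 := by rw [inner_self_eq_norm_sq_to_K, hd]; simp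
    rw [decoupledHom_idMap, ContinuousLinearMap.comp_apply, ContinuousLinearMap.comp_apply,
      hP (b n), this, one_smul, sub_self, map_zero, map_zero]
  · intro x hx
    rw [calcHom_idMap, decoupledHom_idMap, ContinuousLinearMap.comp_apply,
      ← Submodule.inner_starProjection_left_eq_right, ContinuousLinearMap.comp_apply, hP x, hx,
      zero_smul, sub_zero]

/-- The spectral shift function of a bounded self-adjoint operator `A` and of its compression to
the orthogonal complement of a vector. -/
theorem exists_spectral_shift {κ : Type*} (b : HilbertBasis κ ℂ H) (n : κ) {A : H →L[ℂ] H}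
    (hA : IsSelfAdjoint A) {R : ℝ} (hR : 0 < R) (hAR : ‖A‖ ≤ R) :
    ∃ ξ : ℝ → ℝ, Measurable ξ ∧ (∀ᵐ t ∂volume.restrict (Set.Icc (-R) R), 0 ≤ ξ t ∧ ξ t ≤ 1) ∧
      ∀ f : C(ℝ, ℝ), ContDiff ℝ 2 f →
        HasNuclearTrace (calcHom A hA hAR (realMap R f) - decoupledHom (b n) A hA hAR (realMap R f))
          ((f R - f 0 - ∫ t in Set.Icc (-R) R, deriv f t * ξ t : ℝ) : ℂ) := by
  classical
  have hex (F : Finset κ) : ∃ ξ : ℝ → ℝ, Measurable ξ ∧ (n ∈ F → (∀ t, ξ t ∈ Set.Icc (0 : ℝ) 1) ∧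
      ∀ f : C(ℝ, ℝ), ContDiff ℝ 1 f → ∀ τ : ℂ,
        HasSum (fun m => ⟪b m, (calcHom (truncation b F A) (isSelfAdjoint_truncation b F hA)
          ((norm_truncation_le b F A).trans hAR) (realMap R f) -
          decoupledHom (b n) (truncation b F A) (isSelfAdjoint_truncation b F hA)
          ((norm_truncation_le b F A).trans hAR) (realMap R f)) (b m)⟫_ℂ) τ →
        τ = ((f R - f 0 - ∫ t in Set.Icc (-R) R, deriv f t * ξ t : ℝ) : ℂ)) := by
    by_cases hn : n ∈ F
    · obtain ⟨ξ, h1, h2, h3⟩ := exists_truncated_spectral_shift b hA hAR hn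
      exact ⟨ξ, h1, fun _ => ⟨h2, h3⟩⟩
    · exact ⟨0, measurable_const, fun h => absurd h hn⟩
  choose x hxm hx using hex
  have hev : ∀ᶠ F : Finset κ in atTop, n ∈ F :=
    (eventually_ge_atTop {n}).mono fun F hF => hF (Finset.mem_singleton_self n)
  obtain ⟨ξ, hξm, hξ, hlim⟩ := exists_weak_limit (l := atTop) (volume.restrict (Set.Icc (-R) R)) hxm
    (hev.mono fun F hF => (hx F hF).1)
  refine ⟨ξ, hξm, hξ, fun f hf => ?_⟩
  have hd : ‖b n‖ = 1 := b.orthonormal.1 n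
  -- The same factors `a`, `a'` serve `A` and all its truncations, because the norms of the latter
  -- are bounded by `R` too; this is what permits the limit.
  obtain ⟨c, a, a', haa', -, hlip⟩ := exists_operatorLip_of_contDiff (𝒜 := H →L[ℂ] H) hR f hf
  have hf1 : ContDiff ℝ 1 f := hf.of_le one_le_two
  have htr (B : H →L[ℂ] H) (hB : IsSelfAdjoint B) (hBR : ‖B‖ ≤ R) :=
    hasNuclearTrace_sub haa' (hlip (calcHom B hB hBR) (decoupledHom (b n) B hB hBR))
      (calcHom_sub_decoupledHom hd B hB hBR)
  have hAn (u : H) := tendsto_truncation b A u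
  have hcalc := tendsto_starAlgHom_apply (l := atTop)
    (Φ := fun F => calcHom (truncation b F A) (isSelfAdjoint_truncation b F hA)
      ((norm_truncation_le b F A).trans hAR)) (Φ₀ := calcHom A hA hAR)
    (star_idMap_realSeg R) (fun u => by simpa only [calcHom_idMap] using hAn u)
  have hdec := tendsto_starAlgHom_apply (l := atTop)
    (Φ := fun F => decoupledHom (b n) (truncation b F A) (isSelfAdjoint_truncation b F hA)
      ((norm_truncation_le b F A).trans hAR)) (Φ₀ := decoupledHom (b n) A hA hAR)
    (star_idMap_realSeg R) (fun u => by
      simp only [decoupledHom_idMap]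
      exact ((ℂ ∙ b n)ᗮ.starProjection.continuous.tendsto _).comp
          (hAn ((ℂ ∙ b n)ᗮ.starProjection u)))
  have hin : Tendsto (fun F => ⟪truncation b F A (b n), b n⟫_ℂ) atTop (𝓝 ⟪A (b n), b n⟫_ℂ) :=
    (hAn (b n)).inner tendsto_const_nhds
  have ht := (tendsto_tsum_inner hcalc hdec haa'
      ((hAn (b n)).sub (hin.smul_const (b n)))
      (tendsto_const_nhds (x := b n))).add
    (tendsto_tsum_inner hcalc hdec haa' (tendsto_const_nhds (x := b n)) (hAn (b n)))
  have hA0 := htr A hA hAR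
  obtain ⟨τ, hτ⟩ : ∃ τ, τ =
      (∑' k, ⟪decoupledHom (b n) A hA hAR (star (a' k)) (A (b n) - ⟪A (b n), b n⟫_ℂ • b n),
        calcHom A hA hAR (a k) (b n)⟫_ℂ) +
      ∑' k, ⟪decoupledHom (b n) A hA hAR (star (a' k)) (b n),
        calcHom A hA hAR (a k) (A (b n))⟫_ℂ := ⟨_, rfl⟩
  rw [← hτ] at ht hA0
  have ht' : Tendsto (fun F => ((f R - f 0 - ∫ t in Set.Icc (-R) R, deriv f t * x F t : ℝ) : ℂ))
      atTop (𝓝 τ) := by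
    refine ht.congr' ?_
    filter_upwards [hev] with F hF
    exact (hx F hF).2 f hf1 _ ((htr _ _ _).hasSum_inner b)
  have hre : Tendsto (fun F => f R - f 0 - ∫ t in Set.Icc (-R) R, deriv f t * x F t) atTop
      (𝓝 τ.re) := by
    exact (Complex.continuous_re.tendsto τ).comp ht'
  have hreal : τ = (τ.re : ℂ) :=
    tendsto_nhds_unique ht' ((Complex.continuous_ofReal.tendsto τ.re).comp hre)
  have hL2 : MemLp (deriv f) 2 (volume.restrict (Set.Icc (-R) R)) := by
    have hc : Continuous (deriv f) := hf1.continuous_deriv le_rfl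
    obtain ⟨C, hC⟩ := isCompact_Icc.exists_bound_of_continuousOn (s := Set.Icc (-R) R)
      hc.continuousOn
    exact MemLp.of_bound hc.aestronglyMeasurable C
      ((ae_restrict_mem measurableSet_Icc).mono fun x hx => hC x hx)
  -- Convergence of the traces forces convergence of `∫ f' x_F`, so the weak limit integrates `f'`
  -- to the value prescribed by the trace of the limit.
  have hval := hlim (deriv f) (f R - f 0 - τ.re) hL2 (by
    simpa using (tendsto_const_nhds (x := f R - f 0)).sub hre)
  rw [hval, sub_sub_cancel, ← hreal]
  exact hA0

end JacobiTrace

/-! ### Test functions as derivatives, and spectral bounds for compressions -/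

namespace JacobiTrace

theorem integrable_deriv_of_bound {f : ℝ → ℝ} (hf : ContDiff ℝ 1 f)
    (h : ∃ C, ∀ t, |(1 + t ^ 2) * deriv f t| ≤ C) : Integrable (deriv f) := by
  obtain ⟨C, hC⟩ := h
  refine (integrable_inv_one_add_sq.const_mul C).mono'
    (hf.continuous_deriv le_rfl).aestronglyMeasurable (.of_forall fun t => ?_)
  have hpos : 0 < 1 + t ^ 2 := by positivity
  rw [← div_eq_mul_inv, le_div_iff₀ hpos, mul_comm, Real.norm_eq_abs]
  simpa [abs_mul, abs_of_pos hpos] using hC t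

theorem setIntegral_Ioi_deriv {f : ℝ → ℝ} {l : ℝ} (hf : ContDiff ℝ 1 f)
    (h : Integrable (deriv f)) (hl : Tendsto f atTop (𝓝 l)) (a : ℝ) :
    ∫ t in Set.Ioi a, deriv f t = l - f a :=
  integral_Ioi_of_hasDerivAt_of_tendsto'
    (fun t _ => (hf.differentiable one_ne_zero t).hasDerivAt) h.integrableOn hl

/-- A smooth compactly supported function has a primitive to which the trace formula applies. -/
theorem exists_primitive {g : ℝ → ℝ} (hg : ContDiff ℝ 1 g) (hs : HasCompactSupport g) :
    ∃ f : ℝ → ℝ, ContDiff ℝ 2 f ∧ deriv f = g ∧ (∃ C, ∀ t, |(1 + t ^ 2) * deriv f t| ≤ C) ∧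
      Tendsto f atTop (𝓝 (∫ t, g t)) ∧ (∀ t, (∀ s ∈ tsupport g, t < s) → f t = 0) ∧
      ∀ t, (∀ s ∈ tsupport g, s < t) → f t = ∫ t, g t := by
  have hi : Integrable g := hg.continuous.integrable_of_hasCompactSupport hs
  set f : ℝ → ℝ := fun t => ∫ s in Set.Iic t, g s
  have hd (t : ℝ) : HasDerivAt f (g t) t := by
    have h1 : HasDerivAt (fun t => (∫ s in (0 : ℝ)..t, g s) + ∫ s in Set.Iic 0, g s) (g t) t :=
      (intervalIntegral.integral_hasDerivAt_right (hg.continuous.intervalIntegrable _ _)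
        hg.continuous.stronglyMeasurable.stronglyMeasurableAtFilter
        hg.continuous.continuousAt).add_const _
    refine h1.congr_of_eventuallyEq (.of_forall fun t => ?_)
    have := intervalIntegral.integral_Iic_sub_Iic (f := g) (μ := volume) (a := 0) (b := t)
      hi.integrableOn hi.integrableOn
    simp only [f]
    linarith
  have hderiv : deriv f = g := funext fun t => (hd t).deriv
  have hlast (t : ℝ) (ht : ∀ s ∈ tsupport g, s < t) : f t = ∫ t, g t :=
    setIntegral_eq_integral_of_forall_compl_eq_zero fun s hs' =>
      image_eq_zero_of_notMem_tsupport fun h => hs' (ht s h).le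
  refine ⟨f, ?_, hderiv, ?_, ?_, ?_, hlast⟩
  · rw [show (2 : WithTop ℕ∞) = 1 + 1 by norm_num, contDiff_succ_iff_deriv]
    refine ⟨fun t => (hd t).differentiableAt, by simp, by rwa [hderiv]⟩
  · rw [hderiv]
    exact ((continuous_const.add (continuous_pow 2)).mul
      hg.continuous).bounded_above_of_compact_support hs.mul_left
  · obtain ⟨b, hb⟩ := hs.bddAbove
    refine tendsto_const_nhds.congr' ?_
    filter_upwards [eventually_gt_atTop b] with t ht
    exact (hlast t fun s hs' => (hb hs').trans_lt ht).symm
  · intro t ht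
    refine setIntegral_eq_zero_of_forall_eq_zero fun s hs' => ?_
    exact image_eq_zero_of_notMem_tsupport fun h => (ht s h).not_ge hs'

theorem locallyIntegrable_of_mem_Icc {ξ : ℝ → ℝ} (hm : AEMeasurable ξ)
    (h : ∀ᵐ t, 0 ≤ ξ t ∧ ξ t ≤ 1) : LocallyIntegrable ξ := by
  have : MemLp ξ ⊤ volume := memLp_top_of_bound hm.aestronglyMeasurable 1
    (h.mono fun t ht => by rw [Real.norm_eq_abs, abs_of_nonneg ht.1]; exact ht.2)
  exact this.locallyIntegrable le_top

theorem integrable_mul_of_mem_Icc {g ξ : ℝ → ℝ} (hg : Integrable g) (hm : AEMeasurable ξ)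
    (h : ∀ᵐ t, 0 ≤ ξ t ∧ ξ t ≤ 1) : Integrable fun t => g t * ξ t :=
  hg.mul_bdd (c := 1) hm.aestronglyMeasurable
    (h.mono fun t ht => by rw [Real.norm_eq_abs, abs_of_nonneg ht.1]; exact ht.2)

/-- If `ξ` vanishes to the left of `a` and equals `1` to the right of `b`, then `∫ f' ξ` reduces to
an integral over `[a, b]` and a boundary term. -/
theorem integral_deriv_mul {f ξ : ℝ → ℝ} {l a b : ℝ} (hab : a ≤ b) (hf : ContDiff ℝ 1 f)
    (hi : Integrable (deriv f)) (hl : Tendsto f atTop (𝓝 l)) (hm : AEMeasurable ξ)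
    (h01 : ∀ᵐ t, 0 ≤ ξ t ∧ ξ t ≤ 1) (h0 : ∀ᵐ t, t < a → ξ t = 0) (h1 : ∀ᵐ t, b < t → ξ t = 1) :
    ∫ t, deriv f t * ξ t = (∫ t in Set.Icc a b, deriv f t * ξ t) + (l - f b) := by
  have hint := integrable_mul_of_mem_Icc hi hm h01
  have e1 : ∫ t in Set.Iio a, deriv f t * ξ t = 0 := by
    refine setIntegral_eq_zero_of_ae_eq_zero ?_
    filter_upwards [h0] with t ht hta
    rw [ht hta, mul_zero]
  have e2 : ∫ t in Set.Ioi b, deriv f t * ξ t = l - f b := by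
    rw [← setIntegral_Ioi_deriv hf hi hl b]
    refine setIntegral_congr_ae measurableSet_Ioi ?_
    filter_upwards [h1] with t ht htb
    rw [ht htb, mul_one]
  have e3 : Set.Icc a b ∪ Set.Ioi b = Set.Ici a := Set.Icc_union_Ioi_eq_Ici hab
  have e4 : (Set.Iio a)ᶜ = Set.Ici a := Set.compl_Iio
  rw [← integral_add_compl (measurableSet_Iio (a := a)) hint, e1, zero_add, e4, ← e3,
    setIntegral_union (t := Set.Ioi b)
      (Set.disjoint_left.2 fun t ht ht' => (Set.mem_Icc.1 ht).2.not_gt ht')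
      measurableSet_Ioi hint.integrableOn hint.integrableOn, e2]

variable {H : Type*} [NormedAddCommGroup H] [InnerProductSpace ℂ H] [CompleteSpace H]

theorem spectrum_subset_Icc (A : H →L[ℂ] H) :
    spectrum ℝ A ⊆ Set.Icc (sInf (spectrum ℝ A)) (sSup (spectrum ℝ A)) := by
  have hc : IsCompact (spectrum ℝ A) := ContinuousFunctionalCalculus.isCompact_spectrum A
  exact fun t ht => ⟨csInf_le hc.bddBelow ht, le_csSup hc.bddAbove ht⟩

theorem sInf_spectrum_le_sSup [Nontrivial H] {A : H →L[ℂ] H} (hA : IsSelfAdjoint A) :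
    sInf (spectrum ℝ A) ≤ sSup (spectrum ℝ A) := by
  obtain ⟨t, ht⟩ := ContinuousFunctionalCalculus.spectrum_nonempty (R := ℝ) A hA
  have := spectrum_subset_Icc A ht
  exact this.1.trans this.2

theorem forall_le_spectrum_iff {A : H →L[ℂ] H} (hA : IsSelfAdjoint A) {r : ℝ} :
    (∀ x ∈ spectrum ℝ A, r ≤ x) ↔ (A - algebraMap ℝ (H →L[ℂ] H) r).IsPositive := by
  rw [← algebraMap_le_iff_le_spectrum hA, ContinuousLinearMap.le_def]

theorem forall_spectrum_le_iff {A : H →L[ℂ] H} (hA : IsSelfAdjoint A) {r : ℝ} :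
    (∀ x ∈ spectrum ℝ A, x ≤ r) ↔ (algebraMap ℝ (H →L[ℂ] H) r - A).IsPositive := by
  rw [← le_algebraMap_iff_spectrum_le hA, ContinuousLinearMap.le_def]

/-- A spectral lower bound is an operator inequality `r ≤ A`, and compressions preserve positivity.
-/
theorem le_spectrum_compression (K : Submodule ℂ H) [K.HasOrthogonalProjection] {A : H →L[ℂ] H}
    (hA : IsSelfAdjoint A) {r : ℝ} (h : ∀ x ∈ spectrum ℝ A, r ≤ x) :
    ∀ x ∈ spectrum ℝ (compression K A), r ≤ x := by
  rw [forall_le_spectrum_iff hA] at h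
  rw [forall_le_spectrum_iff (isSelfAdjoint_compression K hA)]
  convert h.orthogonalProjectionOnto_comp Kᗮ using 1
  ext u
  simp [compression, Algebra.algebraMap_eq_smul_one]

theorem spectrum_compression_le (K : Submodule ℂ H) [K.HasOrthogonalProjection] {A : H →L[ℂ] H}
    (hA : IsSelfAdjoint A) {r : ℝ} (h : ∀ x ∈ spectrum ℝ A, x ≤ r) :
    ∀ x ∈ spectrum ℝ (compression K A), x ≤ r := by
  rw [forall_spectrum_le_iff hA] at h
  rw [forall_spectrum_le_iff (isSelfAdjoint_compression K hA)]
  convert h.orthogonalProjectionOnto_comp Kᗮ using 1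
  ext u
  simp [compression, Algebra.algebraMap_eq_smul_one]

end JacobiTrace

/-! ### The pair formed by the Jacobi matrix and its decoupling -/

namespace JacobiTrace

/-- The standard basis of the space of square summable sequences. -/
noncomputable def stdBasis : HilbertBasis ℤ ℂ SeqSpace := .ofRepr (.refl ℂ SeqSpace)

theorem stdBasis_apply (m : ℤ) : stdBasis m = delta m := by
  rw [← HilbertBasis.repr_symm_single]
  rfl

theorem norm_delta (n : ℤ) : ‖delta n‖ = 1 := by
  rw [← stdBasis_apply]
  exact stdBasis.orthonormal.1 n

variable (v : ℤ → ℝ) (hv : ∃ C, ∀ m, |v m| ≤ C) (n : ℤ)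

theorem starProjection_delta :
    (ℂ ∙ delta n).starProjection = InnerProductSpace.rankOne ℂ (delta n) (delta n) := by
  ext1 u
  rw [Submodule.starProjection_unit_singleton ℂ (norm_delta n), InnerProductSpace.rankOne_apply]

theorem inner_delta_self : ⟪delta n, delta n⟫_ℂ = 1 := by
  rw [inner_self_eq_norm_sq_to_K, norm_delta]
  simp

theorem hasNuclearTrace_smul_starProjection (c : ℝ) :
    HasNuclearTrace ((c : ℂ) • (ℂ ∙ delta n).starProjection) c := by
  have h := hasNuclearTrace_rankOne (delta n) ((c : ℂ) • delta n)
  rw [inner_smul_right, inner_delta_self, mul_one] at h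
  convert h using 1
  rw [starProjection_delta]
  ext1 u
  change (c : ℂ) • ⟪delta n, u⟫_ℂ • delta n = ⟪delta n, u⟫_ℂ • (c : ℂ) • delta n
  exact smul_comm _ _ _

/-- Exchanging the value `l` at `δ_n` for `f 0` replaces the formal value `+∞` of the decoupled
operator by `0`, at the price of a rank-one term with trace `f 0 - l`. -/
theorem calculusDiff_eq {R : ℝ} (hR : ‖jacobi v hv‖ ≤ R) (f : C(ℝ, ℝ)) (l : ℝ) :
    calculusDiff v hv n f l =
      (calcHom (jacobi v hv) (isSelfAdjoint_jacobi v hv) hR (realMap R f) -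
        decoupledHom (delta n) (jacobi v hv) (isSelfAdjoint_jacobi v hv) hR (realMap R f)) +
      ((f 0 - l : ℝ) : ℂ) • (ℂ ∙ delta n).starProjection := by
  rw [decoupledHom, extendHom_apply, calcHom_realMap, calcHom_realMap, realMap_apply]
  have e : calculusDiff v hv n f l = funcCalc f (jacobi v hv) -
      ((ℂ ∙ delta n)ᗮ.subtypeL ∘L funcCalc f (compression (ℂ ∙ delta n) (jacobi v hv)) ∘L
        (ℂ ∙ delta n)ᗮ.orthogonalProjectionOnto + (l : ℂ) • (ℂ ∙ delta n).starProjection) := rfl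
  rw [e, Complex.ofReal_sub, sub_smul, Complex.zero_re]
  abel

theorem spectrum_dirichlet_subset : spectrum ℝ (dirichlet v hv n) ⊆
    Set.Icc (sInf (spectrum ℝ (jacobi v hv))) (sSup (spectrum ℝ (jacobi v hv))) := by
  have h := spectrum_subset_Icc (jacobi v hv)
  exact fun t ht => ⟨le_spectrum_compression (ℂ ∙ delta n) (isSelfAdjoint_jacobi v hv)
      (fun x hx => (h hx).1) t ht,
    spectrum_compression_le (ℂ ∙ delta n) (isSelfAdjoint_jacobi v hv)
      (fun x hx => (h hx).2) t ht⟩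

theorem sInf_le_sSup_spectrum_jacobi :
    sInf (spectrum ℝ (jacobi v hv)) ≤ sSup (spectrum ℝ (jacobi v hv)) := by
  have : Nontrivial SeqSpace := ⟨⟨delta 0, 0, fun h => by simpa [h] using norm_delta 0⟩⟩
  exact sInf_spectrum_le_sSup (isSelfAdjoint_jacobi v hv)

/-- If `f(t) = c + a t` on the spectrum of `h`, then `f(h) - f(h_D)` is explicit. -/
theorem calculusDiff_of_eq_affine {f : ℝ → ℝ} {a c l : ℝ}
    (h : ∀ t ∈ Set.Icc (sInf (spectrum ℝ (jacobi v hv))) (sSup (spectrum ℝ (jacobi v hv))),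
      f t = c + a * t) :
    HasSum (fun m : ℤ => ⟪delta m, calculusDiff v hv n f l (delta m)⟫_ℂ)
      ((c + a * v n - l : ℝ) : ℂ) := by
  have key {K : Type} [NormedAddCommGroup K] [InnerProductSpace ℂ K] [CompleteSpace K]
      {A : K →L[ℂ] K} (hA : IsSelfAdjoint A) (hs : spectrum ℝ A ⊆
        Set.Icc (sInf (spectrum ℝ (jacobi v hv))) (sSup (spectrum ℝ (jacobi v hv)))) (u : K) :
      funcCalc f A u = (c : ℂ) • u + (a : ℂ) • A u := by
    rw [funcCalc, cfc_congr (g := fun t => c + a * t) fun t ht => h t (hs ht),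
      cfc_const_add c (fun t => a * t) A, cfc_const_mul_id a A]
    simp [Algebra.algebraMap_eq_smul_one]
  have hP := starProjection_orthogonal_singleton_apply (norm_delta n)
  have hinner (m : ℤ) (u : SeqSpace) : ⟪delta m, u⟫_ℂ = u m := by
    rw [delta, lp.inner_single_left]; simp
  have hdelta (m k : ℤ) : delta m k = if k = m then 1 else 0 := by
    rw [delta, lp.single_apply]
    by_cases hk : k = m
    · subst hk; simp
    · simp [hk]
  have happly (u : SeqSpace) : calculusDiff v hv n f l u =
      ((c : ℂ) • u + (a : ℂ) • jacobi v hv u) - (((c : ℂ) • (ℂ ∙ delta n)ᗮ.starProjection u +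
        (a : ℂ) • (ℂ ∙ delta n)ᗮ.starProjection (jacobi v hv ((ℂ ∙ delta n)ᗮ.starProjection u))) +
        (l : ℂ) • (ℂ ∙ delta n).starProjection u) := by
    have h1 := key (isSelfAdjoint_jacobi v hv) (spectrum_subset_Icc _) u
    have h2 := key (isSelfAdjoint_dirichlet v hv n) (spectrum_dirichlet_subset v hv n)
      ((dirichletSpace n).orthogonalProjectionOnto u)
    have e : calculusDiff v hv n f l u = funcCalc f (jacobi v hv) u -
      (((funcCalc f (dirichlet v hv n) ((dirichletSpace n).orthogonalProjectionOnto u) :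
        dirichletSpace n) : SeqSpace) + (l : ℂ) • (ℂ ∙ delta n).starProjection u) := rfl
    rw [e, h1, h2]
    rfl
  -- Decoupling leaves the diagonal entries away from `n` unchanged, so the trace is the single
  -- entry at `n`, where `h_D` contributes just `l`.
  have hterm (m : ℤ) (hm : m ≠ n) : ⟪delta m, calculusDiff v hv n f l (delta m)⟫_ℂ = 0 := by
    have h0 : ⟪delta n, delta m⟫_ℂ = 0 := by rw [hinner, hdelta, if_neg hm.symm]
    have h1 : ⟪delta m, delta n⟫_ℂ = 0 := by rw [hinner, hdelta, if_neg hm]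
    rw [happly, hP (delta m), Submodule.starProjection_unit_singleton ℂ (norm_delta n), h0,
      hP, zero_smul, sub_zero, smul_zero, add_zero, inner_sub_right, inner_add_right,
      inner_add_right, inner_smul_right _ _ (a : ℂ), inner_smul_right _ _ (a : ℂ), inner_sub_right,
      inner_smul_right _ (delta n), h1]
    ring
  have hdiag : ⟪delta n, calculusDiff v hv n f l (delta n)⟫_ℂ = ((c + a * v n - l : ℝ) : ℂ) := by
    have h1 := inner_delta_self n
    have h2 : ⟪delta n, jacobi v hv (delta n)⟫_ℂ = v n := by
      rw [hinner, jacobi_apply]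
      simp [hdelta]
    rw [happly, hP (delta n), Submodule.starProjection_unit_singleton ℂ (norm_delta n), h1,
      one_smul, sub_self, map_zero, map_zero, smul_zero, smul_zero, add_zero, zero_add,
      inner_sub_right, inner_add_right, inner_smul_right, inner_smul_right, inner_smul_right, h1,
      h2]
    push_cast
    ring
  rw [← hdiag]
  exact hasSum_single n hterm

end JacobiTrace

/-! ### Consequences of the trace formula, and existence -/

namespace JacobiTrace

variable {v : ℤ → ℝ} {hv : ∃ C, ∀ m, |v m| ≤ C} {n : ℤ} {ξ : ℝ → ℝ}

/-- The trace formula for the pair `h`, `h_D`. -/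
def TraceFormula (v : ℤ → ℝ) (hv : ∃ C, ∀ m, |v m| ≤ C) (n : ℤ) (ξ : ℝ → ℝ) : Prop :=
  ∀ (f : ℝ → ℝ) (l : ℝ), ContDiff ℝ 2 f → (∃ C, ∀ t, |(1 + t ^ 2) * deriv f t| ≤ C) →
    Tendsto f atTop (𝓝 l) → HasSum (fun m : ℤ => ⟪delta m, calculusDiff v hv n f l (delta m)⟫_ℂ)
      ((-∫ t, deriv f t * ξ t : ℝ) : ℂ)

theorem IsSpectralShift.traceFormula (h : IsSpectralShift v hv n ξ) : TraceFormula v hv n ξ :=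
  fun f l hf hb hl => (h.trace_formula f l hf hb hl).2

theorem TraceFormula.integral_eq (h : TraceFormula v hv n ξ) {f : ℝ → ℝ} {a c l : ℝ}
    (hf : ContDiff ℝ 2 f) (hb : ∃ C, ∀ t, |(1 + t ^ 2) * deriv f t| ≤ C)
    (hl : Tendsto f atTop (𝓝 l))
    (hfc : ∀ t ∈ Set.Icc (sInf (spectrum ℝ (jacobi v hv))) (sSup (spectrum ℝ (jacobi v hv))),
      f t = c + a * t) :
    ∫ t, deriv f t * ξ t = l - c - a * v n := by
  have e := (h f l hf hb hl).unique (calculusDiff_of_eq_affine v hv n hfc)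
  have e' : -∫ t, deriv f t * ξ t = c + a * v n - l := by exact_mod_cast e
  linarith

/-- For a test function `g` supported below the spectrum, its primitive equals `∫ g`, its own limit
at `+∞`, on the whole spectrum. The trace is then `0`, so `∫ g ξ = 0`. -/
theorem TraceFormula.eq_zero (h : TraceFormula v hv n ξ) (hm : AEMeasurable ξ)
    (h01 : ∀ᵐ t, 0 ≤ ξ t ∧ ξ t ≤ 1) :
    ∀ᵐ t, t < sInf (spectrum ℝ (jacobi v hv)) → ξ t = 0 := by
  refine isOpen_Iio.ae_eq_zero_of_integral_contDiff_smul_eq_zero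
    ((locallyIntegrable_of_mem_Icc hm h01).locallyIntegrableOn _) fun g hg hs hU => ?_
  obtain ⟨f, hf, hfg, hb, hl, -, hright⟩ := exists_primitive (hg.of_le (by simp)) hs
  have e := h.integral_eq (a := 0) (c := ∫ t, g t) hf hb hl fun t ht => by
    rw [hright t fun s hs' => (hU hs').trans_le ht.1, zero_mul, add_zero]
  simpa [hfg] using e

/-- For `g` supported above the spectrum, the primitive vanishes on the spectrum and has limit `∫
g`, so `∫ g ξ = ∫ g`. -/
theorem TraceFormula.eq_one (h : TraceFormula v hv n ξ) (hm : AEMeasurable ξ)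
    (h01 : ∀ᵐ t, 0 ≤ ξ t ∧ ξ t ≤ 1) :
    ∀ᵐ t, sSup (spectrum ℝ (jacobi v hv)) < t → ξ t = 1 := by
  have hloc : LocallyIntegrable fun t => ξ t - 1 :=
    (locallyIntegrable_of_mem_Icc hm h01).sub (locallyIntegrable_const 1)
  have key := isOpen_Ioi.ae_eq_zero_of_integral_contDiff_smul_eq_zero
    (U := Set.Ioi (sSup (spectrum ℝ (jacobi v hv)))) (hloc.locallyIntegrableOn _)
    fun g hg hs hU => by
      obtain ⟨f, hf, hfg, hb, hl, hleft, -⟩ := exists_primitive (hg.of_le (by simp)) hs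
      have e := h.integral_eq (a := 0) (c := 0) hf hb hl fun t ht => by
        rw [hleft t fun s hs' => ht.2.trans_lt (hU hs'), zero_mul, add_zero]
      have hi : Integrable g := hg.continuous.integrable_of_hasCompactSupport hs
      simp only [smul_eq_mul, mul_sub, mul_one]
      rw [integral_sub (integrable_mul_of_mem_Icc hi hm h01) hi, ← hfg, e]
      simp [hfg]
  filter_upwards [key] with t ht htU
  linarith [ht htU]

theorem TraceFormula.ae_eq {ξ' : ℝ → ℝ} (h : TraceFormula v hv n ξ) (h' : TraceFormula v hv n ξ')
    (hm : AEMeasurable ξ) (h01 : ∀ᵐ t, 0 ≤ ξ t ∧ ξ t ≤ 1) (hm' : AEMeasurable ξ')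
    (h01' : ∀ᵐ t, 0 ≤ ξ' t ∧ ξ' t ≤ 1) : ξ =ᵐ[volume] ξ' := by
  refine ae_eq_of_integral_contDiff_smul_eq (locallyIntegrable_of_mem_Icc hm h01)
    (locallyIntegrable_of_mem_Icc hm' h01') fun g hg hs => ?_
  obtain ⟨f, hf, hfg, hb, hl, -, -⟩ := exists_primitive (hg.of_le (by simp)) hs
  have e := (h f _ hf hb hl).unique (h' f _ hf hb hl)
  have e' : -∫ t, deriv f t * ξ t = -∫ t, deriv f t * ξ' t := by exact_mod_cast e
  rw [hfg] at e'
  simpa using e'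

/-- The primitive of a bump function equal to `1` on `[a, b]` has slope `1` there, so the trace sees
`v n`. As `ξ` is `0` before `a` and `1` after `b`, only `∫_a^b ξ` and the boundary term `l - f b`
remain. -/
theorem TraceFormula.potential_eq (h : TraceFormula v hv n ξ) (hm : AEMeasurable ξ)
    (h01 : ∀ᵐ t, 0 ≤ ξ t ∧ ξ t ≤ 1) {a b : ℝ} (ha : a ≤ sInf (spectrum ℝ (jacobi v hv)))
    (hb : sSup (spectrum ℝ (jacobi v hv)) ≤ b) :
    v n = b - ∫ t in a..b, ξ t := by
  have hab : a ≤ b := ha.trans ((sInf_le_sSup_spectrum_jacobi v hv).trans hb)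
  -- The margins `1` and `2` keep the radii positive and distinct, since only `a ≤ b` is known.
  set χ : ContDiffBump ((a + b) / 2) := ⟨(b - a) / 2 + 1, (b - a) / 2 + 2, by linarith, by linarith⟩
  have hχ (t : ℝ) (ht : t ∈ Set.Icc a b) : χ t = 1 := by
    refine χ.one_of_mem_closedBall (Metric.mem_closedBall.2 ?_)
    have hr : χ.rIn = (b - a) / 2 + 1 := rfl
    rw [Real.dist_eq, abs_le, hr]
    constructor <;> linarith [ht.1, ht.2]
  obtain ⟨f, hf, hfg, hbd, hl, -, -⟩ := exists_primitive (g := χ) χ.contDiff χ.hasCompactSupport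
  have hf1 : ContDiff ℝ 1 f := hf.of_le one_le_two
  have hft (t : ℝ) (ht : t ∈ Set.Icc a b) : f t = (f b - b) + 1 * t := by
    have e1 : ∫ s in t..b, deriv f s = f b - f t :=
      intervalIntegral.integral_deriv_eq_sub (fun s _ => hf1.differentiable one_ne_zero s)
        ((hf1.continuous_deriv le_rfl).intervalIntegrable _ _)
    have e2 : ∫ s in t..b, deriv f s = ∫ s in t..b, (1 : ℝ) := by
      refine intervalIntegral.integral_congr fun s hs => ?_
      rw [Set.uIcc_of_le ht.2] at hs
      rw [hfg, hχ s ⟨ht.1.trans hs.1, hs.2⟩]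
    rw [e1, intervalIntegral.integral_const, smul_eq_mul, mul_one] at e2
    linarith
  have e := h.integral_eq hf hbd hl fun t ht => hft t ⟨ha.trans ht.1, ht.2.trans hb⟩
  have h0 : ∀ᵐ t, t < a → ξ t = 0 := (h.eq_zero hm h01).mono fun t ht hta => ht (hta.trans_le ha)
  have h1 : ∀ᵐ t, b < t → ξ t = 1 := (h.eq_one hm h01).mono fun t ht htb => ht (hb.trans_lt htb)
  rw [integral_deriv_mul hab hf1 (integrable_deriv_of_bound hf1 hbd) hl hm h01 h0 h1] at e
  have e3 : ∫ t in Set.Icc a b, deriv f t * ξ t = ∫ t in a..b, ξ t := by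
    rw [intervalIntegral.integral_of_le hab, ← integral_Icc_eq_integral_Ioc]
    refine setIntegral_congr_fun measurableSet_Icc fun t ht => ?_
    rw [hfg, hχ t ht, one_mul]
  rw [e3] at e
  linarith

theorem exists_isSpectralShift (v : ℤ → ℝ) (hv : ∃ C, ∀ m, |v m| ≤ C) (n : ℤ) :
    ∃ ξ, IsSpectralShift v hv n ξ := by
  obtain ⟨R, hR⟩ : ∃ R, R = ‖jacobi v hv‖ + 1 := ⟨_, rfl⟩
  have hR0 : 0 < R := by rw [hR]; positivity
  have hAR : ‖jacobi v hv‖ ≤ R := by rw [hR]; linarith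
  obtain ⟨x, hxm, hx01, hx⟩ :=
    exists_spectral_shift stdBasis n (isSelfAdjoint_jacobi v hv) hR0 hAR
  rw [ae_restrict_iff' measurableSet_Icc] at hx01
  -- The value `1` beyond `R` contributes `∫_R^∞ f' = l - f R`, which turns the boundary terms `f R
  -- - f 0` and `f 0 - l` into part of `-∫ f' ξ`.
  set ξ : ℝ → ℝ := fun t => if t < -R then 0 else if t ≤ R then x t else 1
  have hm : Measurable ξ :=
    .ite measurableSet_Iio measurable_const (.ite measurableSet_Iic hxm measurable_const)
  have h01 : ∀ᵐ t, 0 ≤ ξ t ∧ ξ t ≤ 1 := by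
    filter_upwards [hx01] with t ht
    simp only [ξ]
    split_ifs with h1 h2
    · simp
    · exact ht ⟨not_lt.1 h1, h2⟩
    · simp
  have hnuc (f : ℝ → ℝ) (l : ℝ) (hf : ContDiff ℝ 2 f)
      (hb : ∃ C, ∀ t, |(1 + t ^ 2) * deriv f t| ≤ C) (hl : Tendsto f atTop (𝓝 l)) :
      HasNuclearTrace (calculusDiff v hv n f l) ((-∫ t, deriv f t * ξ t : ℝ) : ℂ) := by
    have hf1 : ContDiff ℝ 1 f := hf.of_le one_le_two
    have h1 := hx ⟨f, hf.continuous⟩ hf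
    rw [stdBasis_apply] at h1
    have h2 := h1.add (hasNuclearTrace_smul_starProjection n (f 0 - l))
    have h3 := calculusDiff_eq v hv n hAR ⟨f, hf.continuous⟩ l
    have e : calculusDiff v hv n f l = _ := h3
    rw [e]
    convert h2 using 1
    · rfl
    · have h4 := integral_deriv_mul (by linarith : -R ≤ R) hf1 (integrable_deriv_of_bound hf1 hb) hl
        hm.aemeasurable h01 (.of_forall fun t ht => if_pos ht)
        (.of_forall fun t ht => by
          simp only [ξ]
          rw [if_neg (by linarith), if_neg (not_le.2 ht)])
      have h5 : ∫ t in Set.Icc (-R) R, deriv f t * ξ t =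
          ∫ t in Set.Icc (-R) R, deriv f t * x t := by
        refine setIntegral_congr_fun measurableSet_Icc fun t ht => ?_
        simp only [ξ]
        rw [if_neg (not_lt.2 ht.1), if_pos ht.2]
      rw [← Complex.ofReal_add, h4, h5]
      congr 1
      simp only [ContinuousMap.coe_mk]
      ring
  have hT : TraceFormula v hv n ξ := fun f l hf hb hl => by
    simpa only [stdBasis_apply] using (hnuc f l hf hb hl).hasSum_inner stdBasis
  exact ⟨ξ, hm.aemeasurable,
    fun f l hf hb hl => ⟨(hnuc f l hf hb hl).isTraceClass, hT f l hf hb hl⟩, h01,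
    hT.eq_zero hm.aemeasurable h01⟩

end JacobiTrace

theorem mainTheorem2 (v : ℤ → ℝ) (hv : ∃ C, ∀ m, |v m| ≤ C) (n : ℤ) :
    (∃ ξ : ℝ → ℝ, JacobiTrace.IsSpectralShift v hv n ξ) ∧
    (∀ ξ₁ ξ₂ : ℝ → ℝ, JacobiTrace.IsSpectralShift v hv n ξ₁ →
      JacobiTrace.IsSpectralShift v hv n ξ₂ → ξ₁ =ᵐ[volume] ξ₂) ∧
    ∀ ξ : ℝ → ℝ, JacobiTrace.IsSpectralShift v hv n ξ →
      ∀ E₁ E₂ : ℝ, E₁ ≤ sInf (spectrum ℝ (JacobiTrace.jacobi v hv)) →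
        sSup (spectrum ℝ (JacobiTrace.jacobi v hv)) ≤ E₂ →
        IntervalIntegrable (fun t => 1 / 2 - ξ t) volume E₁ E₂ ∧
        v n = (1 / 2) * (E₁ + E₂) + ∫ t in E₁..E₂, (1 / 2 - ξ t) := by
  refine ⟨JacobiTrace.exists_isSpectralShift v hv n, fun ξ₁ ξ₂ h₁ h₂ =>
    h₁.traceFormula.ae_eq h₂.traceFormula h₁.aemeasurable h₁.mem_Icc h₂.aemeasurable h₂.mem_Icc,
    fun ξ h E₁ E₂ hE₁ hE₂ => ?_⟩
  have hξ : IntervalIntegrable ξ volume E₁ E₂ :=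
    (LocallyIntegrable.integrableOn_isCompact
      (JacobiTrace.locallyIntegrable_of_mem_Icc h.aemeasurable h.mem_Icc)
      isCompact_uIcc).intervalIntegrable
  refine ⟨intervalIntegrable_const.sub hξ, ?_⟩
  rw [intervalIntegral.integral_sub intervalIntegrable_const hξ, intervalIntegral.integral_const,
    h.traceFormula.potential_eq h.aemeasurable h.mem_Icc hE₁ hE₂, smul_eq_mul]
  ring
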